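/- **Setting.** A cell-free massive MIMO system has $M$ access points (APs) with $L$ antennas each, $K$ single-antenna users, bandwidth $B\ge 0$, and pilot signals $\varphi_1,\dots,\varphi_{\tau_p}\in\mathbb{C}^{\tau_p}$ that are orthonormal. The pilot assignment is $p_{kt}\in\{0,1\}$ with $\sum_{t}p_{kt}=1$ for every user $k$. Let $\beta_{mk}>0$ be the large-scale fading coefficients, $\eta_{mk}\ge 0$ the power-control coefficients, and $\rho_p,\rho_d\ge 0$ the normalized pilot and downlink powers. The channels $\mathbf g_{mk}\in\mathbb{C}^L$ have entries distributed as $\mathcal{CN}(0,\beta_{mk})$, the pilot-phase noises $\mathbf W_m\in\mathbb{C}^{L\times\tau_p}$ have entries distributed as $\mathcal{CN}(0,1)$, the receiver noises $w_k$ are $\mathcal{CN}(0,1)$, and the data symbols $q_k$ satisfy $\mathbb{E}q_k=0$, $\mathbb{E}|q_k|^2=1$; all these scalar random variables are mutually independent. AP $m$ receives in the pilot phase $$\mathbf Y_m=\sqrt{\tau_p\rho_p}\sum_{k=1}^K\sum_{t=1}^{\tau_p}p_{kt}\,\mathbf g_{mk}\varphi_t^H+\mathbf W_m ,$$ and forms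 the channel estimates $$\hat{\mathbf g}_{mk}=c_{mk}\,\mathbf Y_m\sum_{t=1}^{\tau_p}p_{kt}\varphi_t,\qquad c_{mk}=\frac{\sqrt{\tau_p\rho_p}\,\beta_{mk}}{\tau_p\rho_p\sum_{j=1}^K\sum_{t'=1}^{\tau_p}\sum_{t=1}^{\tau_p}\beta_{mj}\,|p_{jt'}\varphi_{t'}^H p_{kt}\varphi_t|+1}.$$ Put $\gamma_{mk}=\sqrt{\tau_p\rho_p}\,\beta_{mk}c_{mk}$. With conjugate beamforming AP $m$ sends $\mathbf x_m=\sqrt{\rho_d}\sum_{j=1}^K\sqrt{\eta_{mj}}\,\hat{\mathbf g}_{mj}q_j$, and user $k$ receives $$r_k=\sum_{m=1}^M\mathbf g_{mk}^H\mathbf x_m+w_k .$$ Let $a_k=\sqrt{\rho_d}\sum_{m}\sqrt{\eta_{mk}}\,\mathbf g_{mk}^H\hat{\mathbf g}_{mk}$ be the random coefficient of $q_k$ in $r_k$ and $v_k=r_k-\mathbb{E}[a_k]\,q_k$ the effective noise. The (use-and-then-forget) ergodic throughput of user $k$ is $B\log_2\!\big(1+|\mathbb{E}a_k|^2/\mathbb{E}|v_k|^2\big)$.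 The downlink capacity $C_k$ of user $k$, in bits per channel use, is the supremum of the mutual information between $q_k$ and $r_k$ over all laws of $q_k$ on $\mathbb{C}$ with $\mathbb{E}|q_k|^2=1$, where $q_k$ is independent of the channels, the noises and the other symbols, and the receiver observes only $r_k$. **Lemma.** For every $m,j$, each entry of $\hat{\mathbf g}_{mj}$ is a linear minimum mean square error estimate of the corresponding entry of $\mathbf g_{mj}$ from $\mathbf Y_m$, and it is square integrable with second moment $\gamma_{mj}$. For every user $k$, $a_k$ is integrable, $v_k$ is square integrable with $\mathbb{E}|v_k|^2>0$, and the ergodic throughput of user $k$ equals $$R_{dk}=B\log_2\left(1+\frac{\rho_dL^2\Big(\sum\limits_{m=1}^M\sqrt{\eta_{mk}}\,\gamma_{mk}\Big)^2}{\rho_dL^2\sum\limits_{j\ne k}\Big(\sum\limits_{m=1}^M\sqrt{\eta_{mj}}\,\gamma_{mj}\frac{\beta_{mk}}{\beta_{mj}}\Big)^2\Big|\sum\limits_{t=1}^{\tau_p}\sum\limits_{t'=1}^{\tau_p}p_{jt}\varphi_t^Hp_{kt'}\varphi_{t'}\Big|+\rho_dL\sum\limits_{j=1}^K\sum\limits_{m=1}^M\eta_{mj}\gamma_{mj}\beta_{mk}+1}\right).$$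 This throughput is achievable in the sense that $R_{dk}\le B\,C_k$. Moreover, $R_{dk}$ does not change if $\varphi_1,\dots,\varphi_{\tau_p}$ is replaced by any other orthonormal family of pilots; so, for a given system ($M,K,L,\tau_p,B,\rho_p,\rho_d$), it depends only on the large-scale fading, the power-control coefficients and the pilot assignment. -/

import Mathlib

open MeasureTheory ProbabilityTheory
open scoped ENNReal ComplexConjugate

noncomputable section

/-- The circularly symmetric complex Gaussian law `CN(0, v)`: real and imaginary parts are
independent centred real Gaussians of variance `v / 2`. -/
def complexGaussian (v : ℝ) : Measure ℂ :=
  ((gaussianReal 0 (v / 2).toNNReal).prod (gaussianReal 0 (v / 2).toNNReal)).map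
    (fun z : ℝ × ℝ => (⟨z.1, z.2⟩ : ℂ))

/-- `Xhat` is a linear minimum mean square error estimate of `X` from the finite family of
observations `Y`. -/
def IsLMMSE {Ω ι : Type*} [MeasurableSpace Ω] [Fintype ι] (P : Measure Ω)
    (X : Ω → ℂ) (Y : ι → Ω → ℂ) (Xhat : Ω → ℂ) : Prop :=
  (∃ A : ι → ℂ, ∀ ω, Xhat ω = ∑ i, A i * Y i ω) ∧
    ∀ A : ι → ℂ, ∫ ω, ‖X ω - Xhat ω‖ ^ 2 ∂P ≤ ∫ ω, ‖X ω - ∑ i, A i * Y i ω‖ ^ 2 ∂P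

/-- Mutual information (in nats) between the input `x` of law `μ` and the output `T x ω` of a
channel whose randomness `ω` has law `P` and is independent of the input: the Kullback-Leibler
divergence of the joint law from the product of the marginals. -/
def mutualInfo {Ω : Type*} [MeasurableSpace Ω] (P : Measure Ω) (T : ℂ → Ω → ℂ)
    (μ : Measure ℂ) : ℝ≥0∞ :=
  InformationTheory.klDiv
    ((μ.prod P).map (fun z : ℂ × Ω => (z.1, T z.1 z.2)))
    (μ.prod ((μ.prod P).map (fun z : ℂ × Ω => T z.1 z.2)))

/-- Capacity, in bits per channel use, under the unit power constraint `E |x| ^ 2 = 1`; the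
receiver observes the output only. -/
def channelCapacity {Ω : Type*} [MeasurableSpace Ω] (P : Measure Ω) (T : ℂ → Ω → ℂ) : ℝ≥0∞ :=
  ⨆ (μ : Measure ℂ) (_ : IsProbabilityMeasure μ) (_ : ∫ x, ‖x‖ ^ 2 ∂μ = 1),
    mutualInfo P T μ / ENNReal.ofReal (Real.log 2)

/-- The deterministic parameters of a cell-free system with `M` access points of `L` antennas
each, `K` single-antenna users and `τ` pilots of length `τ`. -/
structure CellFree (M K L τ : ℕ) where
  /-- bandwidth -/
  B : ℝ
  /-- normalized SNR of a pilot symbol -/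
  ρp : ℝ
  /-- maximum normalized downlink power of an access point -/
  ρd : ℝ
  /-- large-scale fading -/
  β : Fin M → Fin K → ℝ
  /-- power control coefficients -/
  η : Fin M → Fin K → ℝ
  /-- pilot assignment indicators -/
  p : Fin K → Fin τ → ℕ
  /-- pilot signals -/
  φ : Fin τ → EuclideanSpace ℂ (Fin τ)

/-- The random quantities: channels `g`, pilot-phase noise `W`, data symbols `q` and
downlink receiver noise `w`. -/
structure CellFreeRV (M K L τ : ℕ) (Ω : Type*) where
  g : Fin M → Fin K → Fin L → Ω → ℂ
  W : Fin M → Fin L → Fin τ → Ω → ℂ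
  q : Fin K → Ω → ℂ
  w : Fin K → Ω → ℂ

namespace CellFree

variable {M K L τ : ℕ} {Ω : Type*}

/-- Standing conditions on the parameters. -/
structure Admissible (S : CellFree M K L τ) : Prop where
  B_nonneg : 0 ≤ S.B
  ρp_nonneg : 0 ≤ S.ρp
  ρd_nonneg : 0 ≤ S.ρd
  β_pos : ∀ m k, 0 < S.β m k
  η_nonneg : ∀ m k, 0 ≤ S.η m k
  p_binary : ∀ k t, S.p k t = 0 ∨ S.p k t = 1
  p_sum : ∀ k, ∑ t, S.p k t = 1
  φ_orthonormal : Orthonormal ℂ S.φ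

/-- All random quantities `g m k l`, `W m l s`, `q k`, `w k` as one family. -/
def allRV (Z : CellFreeRV M K L τ Ω) :
    (Fin M × Fin K × Fin L) ⊕ (Fin M × Fin L × Fin τ) ⊕ Fin K ⊕ Fin K → Ω → ℂ :=
  Sum.elim (fun i => Z.g i.1 i.2.1 i.2.2)
    (Sum.elim (fun i => Z.W i.1 i.2.1 i.2.2) (Sum.elim Z.q Z.w))

/-- The probabilistic model: everything is independent, channels are `CN(0, β m k)`, noises are
`CN(0, 1)`, and data symbols are centred with unit power (of otherwise arbitrary law). -/
structure IsModel [MeasurableSpace Ω] (S : CellFree M K L τ) (P : Measure Ω)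
    (Z : CellFreeRV M K L τ Ω) : Prop where
  measurable : ∀ i, Measurable (allRV Z i)
  indep : iIndepFun (allRV Z) P
  g_law : ∀ m k l, P.map (Z.g m k l) = complexGaussian (S.β m k)
  W_law : ∀ m l s, P.map (Z.W m l s) = complexGaussian 1
  w_law : ∀ k, P.map (Z.w k) = complexGaussian 1
  q_mean : ∀ k, ∫ ω, Z.q k ω ∂P = 0
  q_power : ∀ k, ∫ ω, ‖Z.q k ω‖ ^ 2 ∂P = 1

/-- Entry `(l, s)` of the pilot-phase signal received at access point `m`,
`Y_m = √(τ ρp) ∑ₖ ∑ₜ p_kt g_mk φ_tᴴ + W_m`. -/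
def pilotRx (S : CellFree M K L τ) (Z : CellFreeRV M K L τ Ω)
    (m : Fin M) (l : Fin L) (s : Fin τ) (ω : Ω) : ℂ :=
  (√(τ * S.ρp) : ℂ) * ∑ k, ∑ t, (S.p k t : ℂ) * Z.g m k l ω * starRingEnd ℂ (S.φ t s) + Z.W m l s ω

/-- The coefficient `c_mk`. -/
def c (S : CellFree M K L τ) (m : Fin M) (k : Fin K) : ℝ :=
  √(τ * S.ρp) * S.β m k /
    (τ * S.ρp * ∑ j, ∑ t', ∑ t,
      S.β m j * ‖(S.p j t' : ℂ) * (S.p k t : ℂ) * inner ℂ (S.φ t') (S.φ t)‖ + 1)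

/-- `γ_mk = √(τ ρp) β_mk c_mk`. -/
def γ (S : CellFree M K L τ) (m : Fin M) (k : Fin K) : ℝ :=
  √(τ * S.ρp) * S.β m k * S.c m k

/-- Entry `l` of the channel estimate `ĝ_mk = c_mk Y_m ∑ₜ p_kt φ_t`. -/
def estimate (S : CellFree M K L τ) (Z : CellFreeRV M K L τ Ω)
    (m : Fin M) (k : Fin K) (l : Fin L) (ω : Ω) : ℂ :=
  (S.c m k : ℂ) * ∑ s, S.pilotRx Z m l s ω * ∑ t, (S.p k t : ℂ) * S.φ t s

/-- Entry `l` of the signal sent by access point `m` with conjugate beamforming when the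
symbols are `x`. -/
def transmit (S : CellFree M K L τ) (Z : CellFreeRV M K L τ Ω)
    (x : Fin K → ℂ) (m : Fin M) (l : Fin L) (ω : Ω) : ℂ :=
  (√S.ρd : ℂ) * ∑ j, (√(S.η m j) : ℂ) * S.estimate Z m j l ω * x j

/-- The signal received by user `k` when the symbols are `x`: `∑ₘ g_mkᴴ x_m + w_k`. -/
def received (S : CellFree M K L τ) (Z : CellFreeRV M K L τ Ω)
    (k : Fin K) (x : Fin K → ℂ) (ω : Ω) : ℂ :=
  ∑ m, ∑ l, conj (Z.g m k l ω) * S.transmit Z x m l ω + Z.w k ω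

/-- The downlink channel of user `k`: its own symbol is the input `x`, and the symbols of the
other users are interference. -/
def userChannel (S : CellFree M K L τ) (Z : CellFreeRV M K L τ Ω)
    (k : Fin K) (x : ℂ) (ω : Ω) : ℂ :=
  S.received Z k (Function.update (fun j => Z.q j ω) k x) ω

/-- The random coefficient with which user `k` receives its own symbol. -/
def gain (S : CellFree M K L τ) (Z : CellFreeRV M K L τ Ω) (k : Fin K) (ω : Ω) : ℂ :=
  (√S.ρd : ℂ) * ∑ m, (√(S.η m k) : ℂ) * ∑ l, conj (Z.g m k l ω) * S.estimate Z m k l ω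

/-- The effective noise of user `k`, which only knows the mean of its gain:
`r_k - E[gain] q_k`. -/
def effNoise [MeasurableSpace Ω] (S : CellFree M K L τ) (P : Measure Ω)
    (Z : CellFreeRV M K L τ Ω) (k : Fin K) (ω : Ω) : ℂ :=
  S.received Z k (fun j => Z.q j ω) ω - (∫ ω', S.gain Z k ω' ∂P) * Z.q k ω

/-- The use-and-then-forget ergodic throughput of user `k`. -/
def ergodicThroughput [MeasurableSpace Ω] (S : CellFree M K L τ) (P : Measure Ω)
    (Z : CellFreeRV M K L τ Ω) (k : Fin K) : ℝ :=
  S.B * Real.logb 2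
    (1 + ‖∫ ω, S.gain Z k ω ∂P‖ ^ 2 / ∫ ω, ‖S.effNoise P Z k ω‖ ^ 2 ∂P)

/-- The closed-form downlink rate. -/
def downlinkRate (S : CellFree M K L τ) (k : Fin K) : ℝ :=
  S.B * Real.logb 2 (1 +
    S.ρd * (L : ℝ) ^ 2 * (∑ m, √(S.η m k) * S.γ m k) ^ 2 /
      (S.ρd * (L : ℝ) ^ 2 * ∑ j ∈ Finset.univ.erase k,
          (∑ m, √(S.η m j) * S.γ m j * (S.β m k / S.β m j)) ^ 2 *
            ‖∑ t, ∑ t', (S.p j t : ℂ) * (S.p k t' : ℂ) * inner ℂ (S.φ t) (S.φ t')‖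
        + S.ρd * L * ∑ j, ∑ m, S.η m j * S.γ m j * S.β m k + 1))

end CellFree

end

/-!
At a fixed antenna, the received pilot-phase samples and the channel estimates are linear
combinations of one independent family, the channels to the users and the noise samples. The
estimation error is uncorrelated with all the observations, which is the LMMSE property.
Separating the part of the estimate carried by the channel `g` of user `k`, one has
`conj g * ĝ = κ * ‖g‖ ^ 2 + conj g * E` with `E` centred and independent of `g`; since
`E ‖g‖ ^ 4 = 2 * (E ‖g‖ ^ 2) ^ 2`, its variance is `β * E ‖ĝ‖ ^ 2`, whatever `κ` is. Distinct
antennas are independent, so these variances add up in the gains, and the effective noise is a sum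
of mutually orthogonal terms, one for each symbol and one for the receiver noise.

For achievability take a Gaussian input. By the Donsker–Varadhan inequality its mutual information
with the output is at least the mean of any log-likelihood ratio that integrates to at most one;
the ratio of the Gaussian law around the linear MMSE estimate of the input to the input law gives
exactly the logarithm in the throughput.
-/

section SecondMoments

variable {Ω ι 𝕜 : Type*} [MeasurableSpace Ω] {P : Measure Ω} [RCLike 𝕜]

theorem memLp_of_integral_norm_pow_ne_zero {E : Type*} [NormedAddCommGroup E] {X : Ω → E}
    (hX : AEStronglyMeasurable X P) {n : ℕ} (hn : n ≠ 0) (h : ∫ ω, ‖X ω‖ ^ n ∂P ≠ 0) :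
    MemLp X n P := by
  refine (integrable_norm_rpow_iff hX (by exact_mod_cast hn) (ENNReal.natCast_ne_top n)).1 ?_
  simpa only [ENNReal.toReal_natCast, Real.rpow_natCast] using not_imp_comm.1 integral_undef h

theorem integral_mul_conj_self (X : Ω → 𝕜) :
    ∫ ω, X ω * conj (X ω) ∂P = ((∫ ω, ‖X ω‖ ^ 2 ∂P : ℝ) : 𝕜) := by
  simp_rw [RCLike.mul_conj, ← RCLike.ofReal_pow]
  exact integral_ofReal

variable {X Y : Ω → 𝕜}

theorem integrable_mul_conj (hX : MemLp X 2 P) (hY : MemLp Y 2 P) :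
    Integrable (fun ω => X ω * conj (Y ω)) P :=
  hX.integrable_mul hY.star

theorem integral_norm_sq_add_of_orthogonal (hX : MemLp X 2 P) (hY : MemLp Y 2 P)
    (hXY : ∫ ω, X ω * conj (Y ω) ∂P = 0) :
    ∫ ω, ‖X ω + Y ω‖ ^ 2 ∂P = ∫ ω, ‖X ω‖ ^ 2 ∂P + ∫ ω, ‖Y ω‖ ^ 2 ∂P := by
  have hre : ∫ ω, RCLike.re (X ω * conj (Y ω)) ∂P = 0 := by
    rw [integral_re (integrable_mul_conj hX hY), hXY, map_zero]
  have hsq : ∀ ω, ‖X ω + Y ω‖ ^ 2 =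
      ‖X ω‖ ^ 2 + ‖Y ω‖ ^ 2 + 2 * RCLike.re (X ω * conj (Y ω)) := fun ω => by
    simp only [← RCLike.normSq_eq_def', RCLike.normSq_add]
  have hX2 := hX.integrable_norm_pow two_ne_zero
  have hY2 := hY.integrable_norm_pow two_ne_zero
  simp_rw [hsq]
  rw [integral_add (by exact hX2.add hY2) ((integrable_mul_conj hX hY).re.const_mul 2),
    integral_add hX2 hY2, integral_const_mul, hre, mul_zero, add_zero]

theorem integral_norm_sub_integral_sq [IsProbabilityMeasure P] (hX : MemLp X 2 P) :
    ∫ ω, ‖X ω - ∫ ω', X ω' ∂P‖ ^ 2 ∂P = ∫ ω, ‖X ω‖ ^ 2 ∂P - ‖∫ ω, X ω ∂P‖ ^ 2 := by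
  have hc : MemLp (fun _ => ∫ ω', X ω' ∂P) 2 P := memLp_const _
  have horth : ∫ ω, (X ω - ∫ ω', X ω' ∂P) * conj (∫ ω', X ω' ∂P) ∂P = 0 := by
    rw [integral_mul_const, integral_sub (hX.integrable one_le_two) (integrable_const _)]
    simp
  have h := integral_norm_sq_add_of_orthogonal (hX.sub hc) hc horth
  simp only [Pi.sub_apply, sub_add_cancel, integral_const, probReal_univ, one_smul] at h
  linarith

/- Both sides are still equal when `Y` vanishes almost everywhere, thanks to `x / 0 = 0`. -/
theorem integral_norm_sub_mul_sq (hX : MemLp X 2 P) (hY : MemLp Y 2 P) :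
    ∫ ω, ‖X ω - (∫ ω', X ω' * conj (Y ω') ∂P) / (∫ ω', ‖Y ω'‖ ^ 2 ∂P : ℝ) * Y ω‖ ^ 2 ∂P =
      ∫ ω, ‖X ω‖ ^ 2 ∂P - ‖∫ ω, X ω * conj (Y ω) ∂P‖ ^ 2 / ∫ ω, ‖Y ω‖ ^ 2 ∂P := by
  rcases eq_or_ne (∫ ω, ‖Y ω‖ ^ 2 ∂P) 0 with hD | hD
  · simp [hD]
  set r := ∫ ω, X ω * conj (Y ω) ∂P with hr
  set D := ∫ ω, ‖Y ω‖ ^ 2 ∂P with hDdef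
  have hD' : (D : 𝕜) ≠ 0 := by exact_mod_cast hD
  have hαY : MemLp (fun ω => r / D * Y ω) 2 P := hY.const_mul _
  have horth : ∫ ω, (X ω - r / D * Y ω) * conj (r / D * Y ω) ∂P = 0 := by
    have hexp : ∀ ω, (X ω - r / D * Y ω) * conj (r / D * Y ω) =
        conj (r / D) * (X ω * conj (Y ω) - r / D * (Y ω * conj (Y ω))) := fun ω => by
      rw [map_mul]; ring
    simp_rw [hexp]
    rw [integral_const_mul, integral_sub (integrable_mul_conj hX hY)
      ((integrable_mul_conj hY hY).const_mul _), integral_const_mul, integral_mul_conj_self,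
      ← hr, ← hDdef, div_mul_cancel₀ _ hD', sub_self, mul_zero]
  have h := integral_norm_sq_add_of_orthogonal (hX.sub hαY) hαY horth
  have hα : ∫ ω, ‖r / D * Y ω‖ ^ 2 ∂P = ‖r‖ ^ 2 / D := by
    simp_rw [norm_mul, mul_pow]
    rw [integral_const_mul, norm_div, RCLike.norm_ofReal, div_pow, sq_abs, ← hDdef]
    field_simp
  simp only [Pi.sub_apply, sub_add_cancel, hα] at h
  linarith

variable [Fintype ι] {Z : ι → Ω → 𝕜}

theorem integral_sum_mul_conj_sum (hZ : ∀ i, MemLp (Z i) 2 P)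
    (horth : Pairwise fun i j => ∫ ω, Z i ω * conj (Z j ω) ∂P = 0) (a b : ι → 𝕜) :
    ∫ ω, (∑ i, a i * Z i ω) * conj (∑ j, b j * Z j ω) ∂P =
      ∑ i, a i * conj (b i) * (∫ ω, ‖Z i ω‖ ^ 2 ∂P : ℝ) := by
  have hterm : ∀ i j ω, a i * Z i ω * conj (b j * Z j ω) =
      a i * conj (b j) * (Z i ω * conj (Z j ω)) := fun i j ω => by rw [map_mul]; ring
  have hint : ∀ i j, Integrable (fun ω => a i * conj (b j) * (Z i ω * conj (Z j ω))) P :=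
    fun i j => (integrable_mul_conj (hZ i) (hZ j)).const_mul _
  simp_rw [map_sum, Finset.sum_mul_sum, hterm]
  rw [integral_finsetSum _ fun i _ => integrable_finsetSum _ fun j _ => hint i j]
  refine Finset.sum_congr rfl fun i _ => ?_
  rw [integral_finsetSum _ fun j _ => hint i j, Finset.sum_eq_single i, integral_const_mul,
    integral_mul_conj_self]
  · intro j _ hji
    rw [integral_const_mul, horth hji.symm, mul_zero]
  · simp

theorem integral_norm_sq_sum (hZ : ∀ i, MemLp (Z i) 2 P)
    (horth : Pairwise fun i j => ∫ ω, Z i ω * conj (Z j ω) ∂P = 0) :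
    ∫ ω, ‖∑ i, Z i ω‖ ^ 2 ∂P = ∑ i, ∫ ω, ‖Z i ω‖ ^ 2 ∂P := by
  have h := integral_sum_mul_conj_sum hZ horth 1 1
  simp only [Pi.one_apply, one_mul, map_one, integral_mul_conj_self] at h
  exact_mod_cast h

theorem isLMMSE_of_orthogonal {X : Ω → ℂ} {Y : ι → Ω → ℂ} (hX : MemLp X 2 P)
    (hY : ∀ i, MemLp (Y i) 2 P) (A : ι → ℂ)
    (horth : ∀ i, ∫ ω, X ω * conj (Y i ω) ∂P = ∫ ω, (∑ j, A j * Y j ω) * conj (Y i ω) ∂P) :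
    IsLMMSE P X Y fun ω => ∑ i, A i * Y i ω := by
  have hlin : ∀ B : ι → ℂ, MemLp (fun ω => ∑ i, B i * Y i ω) 2 P := fun B =>
    memLp_finsetSum _ fun i _ => (hY i).const_mul (B i)
  refine ⟨⟨A, fun _ => rfl⟩, fun B => ?_⟩
  have herr : MemLp (fun ω => X ω - ∑ i, A i * Y i ω) 2 P := hX.sub (hlin A)
  have herrY : ∀ i, ∫ ω, (X ω - ∑ j, A j * Y j ω) * conj (Y i ω) ∂P = 0 := fun i => by
    simp_rw [sub_mul]
    rw [integral_sub (integrable_mul_conj hX (hY i)) (integrable_mul_conj (hlin A) (hY i)),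
      horth i, sub_self]
  have horthB : ∫ ω, (X ω - ∑ i, A i * Y i ω) * conj (∑ i, (A - B) i * Y i ω) ∂P = 0 := by
    simp_rw [map_sum, map_mul, Finset.mul_sum, mul_left_comm _ (conj _)]
    rw [integral_finsetSum _ fun i _ => (integrable_mul_conj herr (hY i)).const_mul _]
    simp [integral_const_mul, herrY]
  have hsplit : ∀ ω, X ω - ∑ i, B i * Y i ω =
      (X ω - ∑ i, A i * Y i ω) + ∑ i, (A - B) i * Y i ω := fun ω => by
    simp [sub_mul]
  simp_rw [hsplit]
  rw [integral_norm_sq_add_of_orthogonal herr (hlin _) horthB]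
  exact le_add_of_nonneg_right (integral_nonneg fun ω => sq_nonneg _)

end SecondMoments

section Independence

variable {Ω 𝕜 : Type*} [MeasurableSpace Ω] {P : Measure Ω} [RCLike 𝕜]
  {X Y A N : Ω → 𝕜}

theorem integral_mul_conj_of_indepFun (hXY : IndepFun X Y P) (hX : AEStronglyMeasurable X P)
    (hY : AEStronglyMeasurable Y P) :
    ∫ ω, X ω * conj (Y ω) ∂P = (∫ ω, X ω ∂P) * conj (∫ ω, Y ω ∂P) := by
  rw [← integral_conj]
  exact (hXY.comp measurable_id RCLike.continuous_conj.measurable).integral_fun_mul_eq_mul_integral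
    hX (RCLike.continuous_conj.comp_aestronglyMeasurable hY)

theorem memLp_two_mul_of_indepFun (hXY : IndepFun X Y P) (hX : MemLp X 2 P)
    (hY : MemLp Y 2 P) : MemLp (fun ω => X ω * Y ω) 2 P := by
  refine (memLp_two_iff_integrable_sq_norm (f := fun ω => X ω * Y ω) (hX.1.mul hY.1)).2 ?_
  simp only [norm_mul, mul_pow]
  exact (hXY.comp (φ := fun x => ‖x‖ ^ 2) (ψ := fun y => ‖y‖ ^ 2) (by fun_prop)
    (by fun_prop)).integrable_mul (hX.integrable_norm_pow two_ne_zero)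
    (hY.integrable_norm_pow two_ne_zero)

theorem integral_norm_sq_mul_of_indepFun (hXY : IndepFun X Y P)
    (hX : AEStronglyMeasurable X P) (hY : AEStronglyMeasurable Y P) :
    ∫ ω, ‖X ω * Y ω‖ ^ 2 ∂P = (∫ ω, ‖X ω‖ ^ 2 ∂P) * ∫ ω, ‖Y ω‖ ^ 2 ∂P := by
  simp_rw [norm_mul, mul_pow]
  exact hXY.integral_fun_comp_mul_comp (f := fun x => ‖x‖ ^ 2) (g := fun y => ‖y‖ ^ 2)
    hX.aemeasurable hY.aemeasurable (by fun_prop) (by fun_prop)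

theorem integral_norm_sq_sum_of_indepFun [IsProbabilityMeasure P] {ι : Type*} [Fintype ι]
    {Z : ι → Ω → 𝕜} (hZ : ∀ i, MemLp (Z i) 2 P)
    (hind : Pairwise fun i j => IndepFun (Z i) (Z j) P) :
    ∫ ω, ‖∑ i, Z i ω‖ ^ 2 ∂P =
      ‖∑ i, ∫ ω, Z i ω ∂P‖ ^ 2 + ∑ i, (∫ ω, ‖Z i ω‖ ^ 2 ∂P - ‖∫ ω, Z i ω ∂P‖ ^ 2) := by
  have hZ0 : ∀ i, MemLp (fun ω => Z i ω - ∫ ω', Z i ω' ∂P) 2 P := fun i =>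
    (hZ i).sub (memLp_const _)
  have horth : Pairwise fun i j =>
      ∫ ω, (Z i ω - ∫ ω', Z i ω' ∂P) * conj (Z j ω - ∫ ω', Z j ω' ∂P) ∂P = 0 := fun i j hij => by
    have hij0 : IndepFun (fun ω => Z i ω - ∫ ω', Z i ω' ∂P) (fun ω => Z j ω - ∫ ω', Z j ω' ∂P) P :=
      (hind hij).comp (measurable_id.sub_const _) (measurable_id.sub_const _)
    beta_reduce
    rw [integral_mul_conj_of_indepFun hij0 (hZ0 i).1 (hZ0 j).1,
      integral_sub ((hZ i).integrable one_le_two) (integrable_const _)]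
    simp
  have hvar := integral_norm_sq_sum hZ0 horth
  have hmean : ∫ ω, ∑ i, Z i ω ∂P = ∑ i, ∫ ω, Z i ω ∂P :=
    integral_finsetSum _ fun i _ => (hZ i).integrable one_le_two
  have hsum := integral_norm_sub_integral_sq (X := fun ω => ∑ i, Z i ω) (P := P)
    (memLp_finsetSum Finset.univ fun i _ => hZ i)
  simp only [Finset.sum_sub_distrib, integral_norm_sub_integral_sq (hZ _)] at hvar
  rw [hmean, hvar] at hsum
  rw [Finset.sum_sub_distrib]
  linarith

theorem memLp_two_mul_add_of_indepFun (hind : IndepFun X (fun ω => (A ω, N ω)) P)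
    (hX : MemLp X 2 P) (hA : MemLp A 2 P) (hN : MemLp N 2 P) :
    MemLp (fun ω => A ω * X ω + N ω) 2 P :=
  (memLp_two_mul_of_indepFun (hind.comp measurable_id measurable_fst).symm hA hX).add hN

theorem integral_norm_sq_mul_add_of_indepFun (hind : IndepFun X (fun ω => (A ω, N ω)) P)
    (hX : MemLp X 2 P) (hA : MemLp A 2 P) (hN : MemLp N 2 P) (hX0 : ∫ ω, X ω ∂P = 0) :
    ∫ ω, ‖A ω * X ω + N ω‖ ^ 2 ∂P =
      (∫ ω, ‖A ω‖ ^ 2 ∂P) * ∫ ω, ‖X ω‖ ^ 2 ∂P + ∫ ω, ‖N ω‖ ^ 2 ∂P := by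
  have hXA : IndepFun A X P := (hind.comp measurable_id measurable_fst).symm
  have hXAN : IndepFun X (fun ω => A ω * conj (N ω)) P :=
    hind.comp measurable_id
      (measurable_fst.mul (RCLike.continuous_conj.measurable.comp measurable_snd))
  have horth : ∫ ω, A ω * X ω * conj (N ω) ∂P = 0 := by
    simp_rw [mul_comm (A _), mul_assoc]
    rw [hXAN.integral_fun_mul_eq_mul_integral hX.1 (integrable_mul_conj hA hN).1, hX0, zero_mul]
  rw [integral_norm_sq_add_of_orthogonal (memLp_two_mul_of_indepFun hXA hA hX) hN horth,
    integral_norm_sq_mul_of_indepFun hXA hA.1 hX.1]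

theorem integral_mul_conj_mul_add_of_indepFun (hind : IndepFun X (fun ω => (A ω, N ω)) P)
    (hX : MemLp X 2 P) (hA : MemLp A 2 P) (hN : MemLp N 2 P) (hX0 : ∫ ω, X ω ∂P = 0) :
    ∫ ω, X ω * conj (A ω * X ω + N ω) ∂P =
      conj (∫ ω, A ω ∂P) * (∫ ω, ‖X ω‖ ^ 2 ∂P : ℝ) := by
  have hXN : IndepFun X N P := hind.comp measurable_id measurable_snd
  have hXA : IndepFun (fun ω => X ω * conj (X ω)) A P :=
    hind.comp (measurable_id.mul RCLike.continuous_conj.measurable) measurable_fst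
  have hAX : MemLp (fun ω => A ω * X ω) 2 P :=
    memLp_two_mul_of_indepFun (hind.comp measurable_id measurable_fst).symm hA hX
  have hcomm : ∀ ω, X ω * conj (A ω * X ω) = X ω * conj (X ω) * conj (A ω) := fun ω => by
    rw [map_mul]; ring
  simp_rw [map_add, mul_add]
  rw [integral_add (integrable_mul_conj hX hAX) (integrable_mul_conj hX hN)]
  simp_rw [hcomm]
  rw [integral_mul_conj_of_indepFun hXA (integrable_mul_conj hX hX).1 hA.1, integral_mul_conj_self,
    integral_mul_conj_of_indepFun hXN hX.1 hN.1, hX0, zero_mul, add_zero, mul_comm]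

end Independence

section ComplexGaussian

/-- The density of the law `CN(0, v)` with respect to Lebesgue measure on `ℂ`. It makes the moments
and the translates of `complexGaussian v` accessible; it is junk unless `0 < v`. -/
noncomputable def complexGaussianPDF (v : ℝ) (z : ℂ) : ℝ :=
  (Real.pi * v)⁻¹ * Real.exp (-v⁻¹ * ‖z‖ ^ 2)

theorem continuous_complexGaussianPDF (v : ℝ) : Continuous (complexGaussianPDF v) := by
  unfold complexGaussianPDF
  fun_prop

theorem complexGaussianPDF_pos {v : ℝ} (hv : 0 < v) (z : ℂ) : 0 < complexGaussianPDF v z := by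
  unfold complexGaussianPDF
  positivity

theorem gaussianPDFReal_mul_gaussianPDFReal {v : ℝ} (hv : 0 < v) (x y : ℝ) :
    gaussianPDFReal 0 (v / 2).toNNReal x * gaussianPDFReal 0 (v / 2).toNNReal y =
      complexGaussianPDF v ⟨x, y⟩ := by
  have hnorm : ‖(⟨x, y⟩ : ℂ)‖ ^ 2 = x ^ 2 + y ^ 2 := by
    rw [← Complex.normSq_eq_norm_sq, Complex.normSq_mk]; ring
  have hcoe : ((v / 2).toNNReal : ℝ) = v / 2 := Real.coe_toNNReal _ (half_pos hv).le
  rw [gaussianPDFReal, gaussianPDFReal, complexGaussianPDF, hnorm, hcoe, mul_mul_mul_comm,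
    ← mul_inv, Real.mul_self_sqrt (by positivity), ← Real.exp_add]
  congr 2
  · field_simp
  · field_simp
    ring

theorem complexGaussian_eq_withDensity {v : ℝ} (hv : 0 < v) :
    complexGaussian v = volume.withDensity fun z => ENNReal.ofReal (complexGaussianPDF v z) := by
  have hv' : (v / 2).toNNReal ≠ 0 := by simpa using hv
  have hmp : MeasurePreserving (fun z : ℝ × ℝ => (⟨z.1, z.2⟩ : ℂ)) :=
    Complex.volume_preserving_equiv_real_prod.symm
  have hpdf := continuous_complexGaussianPDF v
  ext s hs
  rw [complexGaussian, gaussianReal_of_var_ne_zero _ hv',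
    prod_withDensity (measurable_gaussianPDF _ _) (measurable_gaussianPDF _ _),
    Measure.map_apply hmp.measurable hs, withDensity_apply _ (hmp.measurable hs),
    withDensity_apply _ hs, ← Measure.volume_eq_prod,
    ← hmp.setLIntegral_comp_preimage hs (by fun_prop)]
  refine lintegral_congr fun z => ?_
  rw [gaussianPDF, gaussianPDF, ← ENNReal.ofReal_mul (gaussianPDFReal_nonneg _ _ _),
    gaussianPDFReal_mul_gaussianPDFReal hv]

instance isProbabilityMeasure_complexGaussian (v : ℝ) :
    IsProbabilityMeasure (complexGaussian v) :=
  Measure.isProbabilityMeasure_map Complex.measurableEquivRealProd.symm.measurable.aemeasurable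

theorem lintegral_complexGaussian {v : ℝ} (hv : 0 < v) {f : ℂ → ℝ≥0∞} (hf : Measurable f) :
    ∫⁻ z, f z ∂complexGaussian v = ∫⁻ z, ENNReal.ofReal (complexGaussianPDF v z) * f z := by
  have hpdf := continuous_complexGaussianPDF v
  rw [complexGaussian_eq_withDensity hv, lintegral_withDensity_eq_lintegral_mul _ (by fun_prop) hf]
  rfl

theorem integral_complexGaussian {E : Type*} [NormedAddCommGroup E] [NormedSpace ℝ E] {v : ℝ}
    (hv : 0 < v) (f : ℂ → E) :
    ∫ z, f z ∂complexGaussian v = ∫ z, complexGaussianPDF v z • f z := by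
  have hpdf := continuous_complexGaussianPDF v
  rw [complexGaussian_eq_withDensity hv,
    integral_withDensity_eq_integral_toReal_smul (by fun_prop) (by simp)]
  simp_rw [ENNReal.toReal_ofReal (complexGaussianPDF_pos hv _).le]

theorem lintegral_complexGaussianPDF_sub {v : ℝ} (hv : 0 < v) (b : ℂ) :
    ∫⁻ z, ENNReal.ofReal (complexGaussianPDF v (z - b)) = 1 := by
  rw [lintegral_sub_right_eq_self (fun z => ENNReal.ofReal (complexGaussianPDF v z)) b]
  simpa using (lintegral_complexGaussian hv measurable_one).symm

theorem integral_complexGaussian_id {v : ℝ} (hv : 0 < v) : ∫ z, z ∂complexGaussian v = 0 := by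
  have heven : ∀ z, complexGaussianPDF v (-z) = complexGaussianPDF v z := fun z => by
    simp only [complexGaussianPDF, norm_neg]
  have hodd := integral_neg_eq_self (fun z => complexGaussianPDF v z • z) volume
  simp only [heven, smul_neg, integral_neg] at hodd
  rw [integral_complexGaussian hv]
  exact self_eq_neg.1 hodd.symm

theorem integral_norm_pow_complexGaussian {v : ℝ} (hv : 0 < v) (n : ℕ) :
    ∫ z, ‖z‖ ^ (2 * n) ∂complexGaussian v = n.factorial * v ^ n := by
  have hgamma : ∫ z : ℂ, ‖z‖ ^ (2 * n) * Real.exp (-v⁻¹ * ‖z‖ ^ 2) =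
      Real.pi * v ^ (n + 1) * n.factorial := by
    have h := Complex.integral_rpow_mul_exp_neg_mul_rpow one_le_two
      (by linarith [n.cast_nonneg (α := ℝ)] : (-2 : ℝ) < 2 * n) (inv_pos.2 hv)
    rw [neg_div, show ((2 * n : ℝ) + 2) / 2 = n + 1 by ring, Real.Gamma_nat_eq_factorial,
      Real.rpow_neg (inv_pos.2 hv).le, Real.inv_rpow hv.le, inv_inv] at h
    rw [mul_div_cancel_left₀ _ two_ne_zero] at h
    exact_mod_cast h
  have hpdf : ∀ z, complexGaussianPDF v z • ‖z‖ ^ (2 * n) =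
      (Real.pi * v)⁻¹ * (‖z‖ ^ (2 * n) * Real.exp (-v⁻¹ * ‖z‖ ^ 2)) := fun z => by
    rw [complexGaussianPDF, smul_eq_mul]; ring
  simp_rw [integral_complexGaussian hv, hpdf]
  rw [integral_const_mul, hgamma, pow_succ']
  field_simp

theorem integral_norm_sq_complexGaussian {v : ℝ} (hv : 0 < v) :
    ∫ z, ‖z‖ ^ 2 ∂complexGaussian v = v := by
  simpa using integral_norm_pow_complexGaussian hv 1

end ComplexGaussian

section MutualInformation

theorem ofReal_integral_sub_log_le_klDiv {α : Type*} [MeasurableSpace α] {J Q : Measure α}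
    [IsProbabilityMeasure J] [IsProbabilityMeasure Q] {f : α → ℝ} (hfJ : Integrable f J)
    (hfQ : Integrable (fun x => Real.exp (f x)) Q) :
    ENNReal.ofReal (∫ x, f x ∂J - Real.log (∫ x, Real.exp (f x) ∂Q)) ≤
      InformationTheory.klDiv J Q := by
  by_cases hac : J ≪ Q
  swap
  · simp [InformationTheory.klDiv_of_not_ac hac]
  by_cases hllr : Integrable (llr J Q) J
  swap
  · simp [InformationTheory.klDiv_of_not_integrable hllr]
  have := isProbabilityMeasure_tilted hfQ
  have htilted := InformationTheory.integral_llr_add_sub_measure_univ_nonneg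
    (hac.trans (absolutelyContinuous_tilted hfQ))
    (integrable_llr_tilted_right hac hfJ hllr hfQ)
  rw [integral_llr_tilted_right hac hfJ hfQ hllr] at htilted
  rw [InformationTheory.klDiv_of_ac_of_integrable hac hllr]
  refine ENNReal.ofReal_le_ofReal ?_
  simp only [probReal_univ] at htilted ⊢
  linarith

theorem ofReal_integral_log_le_klDiv {α : Type*} [MeasurableSpace α] {J Q : Measure α}
    [IsProbabilityMeasure J] [IsProbabilityMeasure Q] {r : α → ℝ} (hr : Measurable r)
    (hpos : ∀ x, 0 < r x) (hrQ : ∫⁻ x, ENNReal.ofReal (r x) ∂Q = 1)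
    (hrJ : Integrable (fun x => Real.log (r x)) J) :
    ENNReal.ofReal (∫ x, Real.log (r x) ∂J) ≤ InformationTheory.klDiv J Q := by
  have hnonneg : 0 ≤ᵐ[Q] r := .of_forall fun x => (hpos x).le
  have hint : Integrable r Q :=
    ⟨hr.aestronglyMeasurable, (hasFiniteIntegral_iff_ofReal hnonneg).2 (by simp [hrQ])⟩
  have hone : ∫ x, r x ∂Q = 1 := by
    rw [integral_eq_lintegral_of_nonneg_ae hnonneg hint.1, hrQ, ENNReal.toReal_one]
  have h := ofReal_integral_sub_log_le_klDiv (Q := Q) hrJ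
    (by simpa only [Real.exp_log (hpos _)] using hint)
  simpa only [Real.exp_log (hpos _), hone, Real.log_one, sub_zero] using h

theorem log_complexGaussianPDF_div {v s : ℝ} (hv : 0 < v) (hs : 0 < s) (x y : ℂ) :
    Real.log (complexGaussianPDF s y / complexGaussianPDF v x) =
      Real.log (v / s) + (‖x‖ ^ 2 / v - ‖y‖ ^ 2 / s) := by
  have hlog : ∀ {u : ℝ}, 0 < u → ∀ z,
      Real.log (complexGaussianPDF u z) = -Real.log Real.pi - Real.log u - ‖z‖ ^ 2 / u :=
    fun {u} hu z => by
      rw [complexGaussianPDF, Real.log_mul (by positivity) (by positivity), Real.log_exp,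
        Real.log_inv, Real.log_mul (by positivity) (by positivity)]
      ring
  rw [Real.log_div (complexGaussianPDF_pos hs y).ne' (complexGaussianPDF_pos hv x).ne',
    Real.log_div hv.ne' hs.ne', hlog hs, hlog hv]
  ring

theorem lintegral_complexGaussianPDF_sub_div {v s : ℝ} (hv : 0 < v) (hs : 0 < s) (b : ℂ) :
    ∫⁻ x, ENNReal.ofReal (complexGaussianPDF s (x - b) / complexGaussianPDF v x)
      ∂complexGaussian v = 1 := by
  have hpdf := continuous_complexGaussianPDF
  rw [lintegral_complexGaussian hv (by fun_prop), ← lintegral_complexGaussianPDF_sub hs b]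
  refine lintegral_congr fun x => ?_
  rw [← ENNReal.ofReal_mul (complexGaussianPDF_pos hv x).le,
    mul_div_cancel₀ _ (complexGaussianPDF_pos hv x).ne']

variable {Ω : Type*} [MeasurableSpace Ω] {P : Measure Ω} [IsProbabilityMeasure P]

theorem integral_log_complexGaussianPDF_div {v s : ℝ} (hv : 0 < v) (hs : 0 < s) {X Y : Ω → ℂ}
    (hX : ∫ ω, ‖X ω‖ ^ 2 ∂P = v) (hY : ∫ ω, ‖Y ω‖ ^ 2 ∂P = s) :
    Integrable (fun ω => Real.log (complexGaussianPDF s (Y ω) / complexGaussianPDF v (X ω))) P ∧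
      ∫ ω, Real.log (complexGaussianPDF s (Y ω) / complexGaussianPDF v (X ω)) ∂P =
        Real.log (v / s) := by
  have hX2 : Integrable (fun ω => ‖X ω‖ ^ 2) P :=
    not_imp_comm.1 integral_undef (hX.trans_ne hv.ne')
  have hY2 : Integrable (fun ω => ‖Y ω‖ ^ 2) P :=
    not_imp_comm.1 integral_undef (hY.trans_ne hs.ne')
  have hdiff := (hX2.div_const v).sub (hY2.div_const s)
  simp_rw [log_complexGaussianPDF_div hv hs]
  refine ⟨(integrable_const _).add hdiff, ?_⟩
  rw [integral_add (integrable_const _) (by exact hdiff),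
    integral_sub (hX2.div_const v) (hY2.div_const s), integral_div, integral_div, hX, hY,
    div_self hv.ne', div_self hs.ne']
  simp

/- Donsker–Varadhan with the log-likelihood ratio of the backward channel that guesses the input
to have law `CN(h y, s)` when the output is `y`. -/
theorem ofReal_log_div_le_mutualInfo {v : ℝ} (hv : 0 < v) {T : ℂ → Ω → ℂ}
    (hT : Measurable fun z : ℂ × Ω => T z.1 z.2) {h : ℂ → ℂ} (hh : Measurable h)
    (hs : 0 < ∫ z : ℂ × Ω, ‖z.1 - h (T z.1 z.2)‖ ^ 2 ∂(complexGaussian v).prod P) :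
    ENNReal.ofReal (Real.log
        (v / ∫ z : ℂ × Ω, ‖z.1 - h (T z.1 z.2)‖ ^ 2 ∂(complexGaussian v).prod P)) ≤
      mutualInfo P T (complexGaussian v) := by
  set s := ∫ z : ℂ × Ω, ‖z.1 - h (T z.1 z.2)‖ ^ 2 ∂(complexGaussian v).prod P with hs_def
  have hpdf := continuous_complexGaussianPDF
  have hpair : Measurable fun z : ℂ × Ω => (z.1, T z.1 z.2) := measurable_fst.prodMk hT
  have : IsProbabilityMeasure (((complexGaussian v).prod P).map fun z => T z.1 z.2) :=
    Measure.isProbabilityMeasure_map hT.aemeasurable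
  have : IsProbabilityMeasure (((complexGaussian v).prod P).map fun z => (z.1, T z.1 z.2)) :=
    Measure.isProbabilityMeasure_map hpair.aemeasurable
  let r : ℂ × ℂ → ℝ := fun z => complexGaussianPDF s (z.1 - h z.2) / complexGaussianPDF v z.1
  have hr : Measurable r := by fun_prop
  have hrQ : ∫⁻ z, ENNReal.ofReal (r z)
      ∂(complexGaussian v).prod (((complexGaussian v).prod P).map fun z => T z.1 z.2) = 1 := by
    rw [lintegral_prod_symm' _ (by fun_prop)]
    simp [r, lintegral_complexGaussianPDF_sub_div hv hs]
  have hx2 : ∫ z : ℂ × Ω, ‖z.1‖ ^ 2 ∂(complexGaussian v).prod P = v := by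
    rw [integral_fun_fst fun x : ℂ => ‖x‖ ^ 2, integral_norm_sq_complexGaussian hv]
    simp
  obtain ⟨hint, hval⟩ := integral_log_complexGaussianPDF_div hv hs hx2 hs_def.symm
  have hlogr : AEStronglyMeasurable (fun z => Real.log (r z))
      (((complexGaussian v).prod P).map fun z => (z.1, T z.1 z.2)) :=
    hr.log.aestronglyMeasurable
  rw [← hval, ← integral_map (f := fun z => Real.log (r z)) hpair.aemeasurable hlogr]
  exact ofReal_integral_log_le_klDiv hr
    (fun z => div_pos (complexGaussianPDF_pos hs _) (complexGaussianPDF_pos hv _)) hrQ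
    ((integrable_map_measure hlogr hpair.aemeasurable).2 hint)

end MutualInformation

section Capacity

variable {Ω : Type*} [MeasurableSpace Ω] {P : Measure Ω} [IsProbabilityMeasure P] {A N : Ω → ℂ}

theorem integral_norm_sub_div_mul_mul_add_sq {X : Ω → ℂ}
    (hind : IndepFun X (fun ω => (A ω, N ω)) P) (hX : MemLp X 2 P) (hA : MemLp A 2 P)
    (hN : MemLp N 2 P) (hX0 : ∫ ω, X ω ∂P = 0) (hX1 : ∫ ω, ‖X ω‖ ^ 2 ∂P = 1)
    (hnoise : 0 < ∫ ω, ‖A ω - ∫ ω', A ω' ∂P‖ ^ 2 ∂P + ∫ ω, ‖N ω‖ ^ 2 ∂P) :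
    ∫ ω, ‖X ω - conj (∫ ω', A ω' ∂P) / ((∫ ω', ‖A ω'‖ ^ 2 ∂P) + ∫ ω', ‖N ω'‖ ^ 2 ∂P : ℝ) *
        (A ω * X ω + N ω)‖ ^ 2 ∂P =
      (1 + ‖∫ ω, A ω ∂P‖ ^ 2 /
        (∫ ω, ‖A ω - ∫ ω', A ω' ∂P‖ ^ 2 ∂P + ∫ ω, ‖N ω‖ ^ 2 ∂P))⁻¹ := by
  have hcross := integral_mul_conj_mul_add_of_indepFun hind hX hA hN hX0
  have hpower := integral_norm_sq_mul_add_of_indepFun hind hX hA hN hX0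
  have hmmse := integral_norm_sub_mul_sq hX (memLp_two_mul_add_of_indepFun hind hX hA hN)
  simp only [hcross, hpower, hX1, mul_one, Complex.coe_algebraMap, Complex.ofReal_one,
    RCLike.norm_conj] at hmmse
  rw [hmmse, eq_add_of_sub_eq (integral_norm_sub_integral_sq hA).symm, add_right_comm, add_comm]
  generalize ∫ ω, ‖A ω - ∫ ω', A ω' ∂P‖ ^ 2 ∂P + ∫ ω, ‖N ω‖ ^ 2 ∂P = v at hnoise ⊢
  field_simp
  ring

theorem ofReal_log_le_mutualInfo_mul_add (hAm : Measurable A) (hNm : Measurable N)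
    (hA : MemLp A 2 P) (hN : MemLp N 2 P)
    (hnoise : 0 < ∫ ω, ‖A ω - ∫ ω', A ω' ∂P‖ ^ 2 ∂P + ∫ ω, ‖N ω‖ ^ 2 ∂P) :
    ENNReal.ofReal (Real.log (1 + ‖∫ ω, A ω ∂P‖ ^ 2 /
        (∫ ω, ‖A ω - ∫ ω', A ω' ∂P‖ ^ 2 ∂P + ∫ ω, ‖N ω‖ ^ 2 ∂P))) ≤
      mutualInfo P (fun x ω => A ω * x + N ω) (complexGaussian 1) := by
  have hfst : ∀ {E : Type} [NormedAddCommGroup E] [NormedSpace ℝ E] (f : ℂ → E),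
      ∫ z, f z.1 ∂(complexGaussian 1).prod P = ∫ x, f x ∂complexGaussian 1 := fun f => by
    rw [integral_fun_fst, probReal_univ, one_smul]
  have hsnd : ∀ {E : Type} [NormedAddCommGroup E] [NormedSpace ℝ E] (f : Ω → E),
      ∫ z, f z.2 ∂(complexGaussian 1).prod P = ∫ ω, f ω ∂P := fun f => by
    rw [integral_fun_snd, probReal_univ, one_smul]
  have hX0 : ∫ z : ℂ × Ω, z.1 ∂(complexGaussian 1).prod P = 0 :=
    (hfst fun x => x).trans (integral_complexGaussian_id one_pos)
  have hX1 : ∫ z : ℂ × Ω, ‖z.1‖ ^ 2 ∂(complexGaussian 1).prod P = 1 :=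
    (hfst fun x => ‖x‖ ^ 2).trans (integral_norm_sq_complexGaussian one_pos)
  have hX : MemLp (fun z : ℂ × Ω => z.1) (2 : ℕ) ((complexGaussian 1).prod P) :=
    memLp_of_integral_norm_pow_ne_zero measurable_fst.aestronglyMeasurable two_ne_zero
      (hX1.trans_ne one_ne_zero)
  have hind : IndepFun (fun z : ℂ × Ω => z.1) (fun z : ℂ × Ω => (A z.2, N z.2))
      ((complexGaussian 1).prod P) :=
    indepFun_prod measurable_id (hAm.prodMk hNm)
  have hA' : MemLp (fun z : ℂ × Ω => A z.2) 2 ((complexGaussian 1).prod P) :=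
    hA.comp_measurePreserving measurePreserving_snd
  have hN' : MemLp (fun z : ℂ × Ω => N z.2) 2 ((complexGaussian 1).prod P) :=
    hN.comp_measurePreserving measurePreserving_snd
  have hmse := integral_norm_sub_div_mul_mul_add_sq hind (by exact_mod_cast hX) hA' hN' hX0 hX1
    (by rwa [hsnd A, hsnd fun ω => ‖A ω - ∫ ω', A ω' ∂P‖ ^ 2, hsnd fun ω => ‖N ω‖ ^ 2])
  rw [hsnd A, hsnd fun ω => ‖A ω - ∫ ω', A ω' ∂P‖ ^ 2, hsnd fun ω => ‖A ω‖ ^ 2,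
    hsnd fun ω => ‖N ω‖ ^ 2] at hmse
  have hbound := ofReal_log_div_le_mutualInfo (P := P) one_pos
    (T := fun x ω => A ω * x + N ω) (by fun_prop)
    (h := fun y => conj (∫ ω, A ω ∂P) /
      ((∫ ω, ‖A ω‖ ^ 2 ∂P) + ∫ ω, ‖N ω‖ ^ 2 ∂P : ℝ) * y) (by fun_prop)
    (hmse ▸ by positivity)
  rwa [hmse, one_div, inv_inv] at hbound

theorem ofReal_logb_le_channelCapacity (hAm : Measurable A) (hNm : Measurable N)
    (hA : MemLp A 2 P) (hN : MemLp N 2 P)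
    (hnoise : 0 < ∫ ω, ‖A ω - ∫ ω', A ω' ∂P‖ ^ 2 ∂P + ∫ ω, ‖N ω‖ ^ 2 ∂P) :
    ENNReal.ofReal (Real.logb 2 (1 + ‖∫ ω, A ω ∂P‖ ^ 2 /
        (∫ ω, ‖A ω - ∫ ω', A ω' ∂P‖ ^ 2 ∂P + ∫ ω, ‖N ω‖ ^ 2 ∂P))) ≤
      channelCapacity P fun x ω => A ω * x + N ω := by
  rw [Real.logb, ENNReal.ofReal_div_of_pos (Real.log_pos one_lt_two)]
  refine le_iSup_of_le (complexGaussian 1) (le_iSup_of_le inferInstance (le_iSup_of_le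
    (integral_norm_sq_complexGaussian one_pos) ?_))
  exact ENNReal.div_le_div_right (ofReal_log_le_mutualInfo_mul_add hAm hNm hA hN hnoise) _

end Capacity

section Beamforming

variable {Ω 𝕜 : Type*} [MeasurableSpace Ω] {P : Measure Ω} [RCLike 𝕜] {G E : Ω → 𝕜}

theorem memLp_two_const_mul_conj_mul_self (hG : MemLp G 4 P) (κ : 𝕜) :
    MemLp (fun ω => κ * (conj (G ω) * G ω)) 2 P := by
  refine MemLp.const_mul ((memLp_two_iff_integrable_sq_norm (hG.1.star.mul hG.1)).2 ?_) κ
  refine (hG.integrable_norm_pow (p := 4) four_ne_zero).congr (.of_forall fun ω => ?_)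
  simp only [Pi.mul_apply, Pi.star_apply, norm_mul, norm_star]
  ring

theorem memLp_two_conj_mul_add_of_indepFun [IsFiniteMeasure P] (hGE : IndepFun G E P)
    (hG : MemLp G 4 P) (hE : MemLp E 2 P) (κ : 𝕜) :
    MemLp (fun ω => conj (G ω) * (κ * G ω + E ω)) 2 P := by
  have hG2 : MemLp (fun ω => conj (G ω)) 2 P := (hG.mono_exponent (by norm_num)).star
  have hind : IndepFun (fun ω => conj (G ω)) E P :=
    hGE.comp RCLike.continuous_conj.measurable measurable_id
  simp_rw [mul_add, mul_left_comm _ κ]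
  exact (memLp_two_const_mul_conj_mul_self hG κ).add (memLp_two_mul_of_indepFun hind hG2 hE)

theorem integral_conj_mul_add_of_indepFun (hGE : IndepFun G E P) (hG : MemLp G 2 P)
    (hE : MemLp E 2 P) (hE0 : ∫ ω, E ω ∂P = 0) (κ : 𝕜) :
    ∫ ω, conj (G ω) * (κ * G ω + E ω) ∂P = κ * (∫ ω, ‖G ω‖ ^ 2 ∂P : ℝ) := by
  simp_rw [mul_comm (conj _), add_mul, mul_assoc]
  rw [integral_add ((integrable_mul_conj hG hG).const_mul κ) (integrable_mul_conj hE hG),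
    integral_const_mul, integral_mul_conj_self, integral_mul_conj_of_indepFun hGE.symm hE.1 hG.1,
    hE0, zero_mul, add_zero]

/- `hG4` is the relation between the moments of a circularly symmetric Gaussian law. -/
theorem integral_norm_sq_conj_mul_add_of_indepFun [IsProbabilityMeasure P] (hGE : IndepFun G E P)
    (hG : MemLp G 4 P) (hE : MemLp E 2 P) (hE0 : ∫ ω, E ω ∂P = 0)
    (hG4 : ∫ ω, ‖G ω‖ ^ 4 ∂P = 2 * (∫ ω, ‖G ω‖ ^ 2 ∂P) ^ 2) (κ : 𝕜) :
    ∫ ω, ‖conj (G ω) * (κ * G ω + E ω)‖ ^ 2 ∂P =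
      ‖κ * (∫ ω, ‖G ω‖ ^ 2 ∂P : ℝ)‖ ^ 2 +
        (∫ ω, ‖G ω‖ ^ 2 ∂P) * ∫ ω, ‖κ * G ω + E ω‖ ^ 2 ∂P := by
  have hG2 : MemLp G 2 P := hG.mono_exponent (by norm_num)
  have hconj : Measurable (starRingEnd 𝕜) := RCLike.continuous_conj.measurable
  have hind : IndepFun E (fun ω => (conj (G ω), κ * (conj (G ω) * G ω))) P :=
    hGE.symm.comp measurable_id
      (hconj.prodMk ((hconj.mul measurable_id).const_mul κ))
  have hind1 : IndepFun E (fun ω => ((1 : 𝕜), κ * G ω)) P :=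
    hGE.symm.comp measurable_id (measurable_const.prodMk (measurable_const_mul κ))
  have hproduct := integral_norm_sq_mul_add_of_indepFun hind hE hG2.star
    (memLp_two_const_mul_conj_mul_self hG κ) hE0
  have hfactor := integral_norm_sq_mul_add_of_indepFun hind1 hE (memLp_const 1)
    (hG2.const_mul κ) hE0
  have hexp : ∀ ω, conj (G ω) * (κ * G ω + E ω) = conj (G ω) * E ω + κ * (conj (G ω) * G ω) :=
    fun ω => by ring
  have hsq : ∀ ω, ‖κ * (conj (G ω) * G ω)‖ ^ 2 = ‖κ‖ ^ 2 * ‖G ω‖ ^ 4 := fun ω => by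
    rw [norm_mul, norm_mul, RCLike.norm_conj]; ring
  simp only [one_mul, norm_one, one_pow, integral_const, probReal_univ, one_smul,
    add_comm (E _), norm_mul, mul_pow, integral_const_mul] at hfactor
  simp_rw [hexp, hproduct, hsq, RCLike.norm_conj]
  rw [hfactor, integral_const_mul, hG4, norm_mul, RCLike.norm_ofReal, mul_pow, sq_abs]
  ring

end Beamforming

section GeneratedBy

variable {Ω ι β : Type*} [MeasurableSpace β]

/-- The σ-algebra generated by the members of the family `X` with index in `T`; functions
measurable with respect to it are those that depend on these members only. -/
abbrev generatedBy (X : ι → Ω → β) (T : Set ι) : MeasurableSpace Ω :=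
  ⨆ i ∈ T, MeasurableSpace.comap (X i) inferInstance

theorem measurable_generatedBy (X : ι → Ω → β) {T : Set ι} {i : ι} (hi : i ∈ T) :
    Measurable[generatedBy X T] (X i) :=
  Measurable.of_comap_le (le_iSup₂_of_le i hi le_rfl)

theorem indepFun_of_disjoint [MeasurableSpace Ω] {P : Measure Ω} {X : ι → Ω → β}
    (hX : ∀ i, Measurable (X i)) (hind : iIndepFun X P) {T T' : Set ι} (hT : Disjoint T T')
    {γ δ : Type*} [MeasurableSpace γ] [MeasurableSpace δ] {f : Ω → γ} {g : Ω → δ}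
    (hf : Measurable[generatedBy X T] f) (hg : Measurable[generatedBy X T'] g) :
    IndepFun f g P := by
  have h := indep_iSup_of_disjoint (fun i => (hX i).comap_le) hind.iIndep hT
  exact (IndepFun_iff_Indep _ _ _).2 (indep_of_indep_of_le_left
    (indep_of_indep_of_le_right h hg.comap_le) hf.comap_le)

end GeneratedBy

namespace CellFree

section Pilots

variable {M K L τ : ℕ} {S : CellFree M K L τ}

/-- The pilot `∑ₜ p_kt φ_t` sent by user `k`. -/
noncomputable def pilot (S : CellFree M K L τ) (k : Fin K) : EuclideanSpace ℂ (Fin τ) :=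
  ∑ t, (S.p k t : ℂ) • S.φ t

theorem pilot_apply (S : CellFree M K L τ) (k : Fin K) (s : Fin τ) :
    S.pilot k s = ∑ t, (S.p k t : ℂ) * S.φ t s := by
  simp [pilot]

theorem pilot_congr {j k : Fin K} (h : S.p j = S.p k) : S.pilot j = S.pilot k := by
  rw [pilot, h, pilot]

theorem sum_conj_pilot_mul_pilot (S : CellFree M K L τ) (j k : Fin K) :
    ∑ s, conj (S.pilot j s) * S.pilot k s = inner ℂ (S.pilot j) (S.pilot k) := by
  simp only [PiLp.inner_apply, RCLike.inner_apply']

theorem inner_pilot_pilot (S : CellFree M K L τ) (j k : Fin K) :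
    inner ℂ (S.pilot j) (S.pilot k) =
      ∑ t, ∑ t', (S.p j t : ℂ) * (S.p k t' : ℂ) * inner ℂ (S.φ t) (S.φ t') := by
  simp_rw [pilot, sum_inner, inner_sum, inner_smul_left, inner_smul_right, map_natCast, mul_assoc]

theorem Admissible.exists_p_eq_single (hS : S.Admissible) (k : Fin K) :
    ∃ t, S.p k = Pi.single t 1 := by
  obtain ⟨t, -, ht⟩ : ∃ t ∈ Finset.univ, S.p k t ≠ 0 :=
    Finset.exists_ne_zero_of_sum_ne_zero (by rw [hS.p_sum k]; exact one_ne_zero)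
  have ht1 : S.p k t = 1 := (hS.p_binary k t).resolve_left ht
  have hsum := hS.p_sum k
  rw [← Finset.add_sum_erase _ _ (Finset.mem_univ t), ht1, Nat.add_eq_left] at hsum
  refine ⟨t, funext fun s => ?_⟩
  rcases eq_or_ne s t with rfl | hs
  · rw [ht1, Pi.single_eq_same]
  · rw [Pi.single_eq_of_ne hs]
    exact Finset.sum_eq_zero_iff.1 hsum s (Finset.mem_erase.2 ⟨hs, Finset.mem_univ s⟩)

theorem Admissible.exists_pilotIndex (hS : S.Admissible) (j k : Fin K) :
    ∃ t t', S.p j = Pi.single t 1 ∧ S.p k = Pi.single t' 1 ∧ (S.p j = S.p k ↔ t = t') := by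
  obtain ⟨t, ht⟩ := hS.exists_p_eq_single j
  obtain ⟨t', ht'⟩ := hS.exists_p_eq_single k
  refine ⟨t, t', ht, ht', fun h => ?_, fun h => by rw [ht, ht', h]⟩
  by_contra hne
  simpa [ht, ht', Pi.single_apply, hne] using congrFun h t

theorem Admissible.sum_norm_inner (hS : S.Admissible) (j k : Fin K) :
    ∑ t, ∑ t', ‖(S.p j t : ℂ) * (S.p k t' : ℂ) * inner ℂ (S.φ t) (S.φ t')‖ =
      if S.p j = S.p k then 1 else 0 := by
  obtain ⟨t, t', ht, ht', hiff⟩ := hS.exists_pilotIndex j k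
  simp only [hiff, eq_comm (a := t)]
  simp [ht, ht', Pi.single_apply, orthonormal_iff_ite.1 hS.φ_orthonormal, apply_ite]

theorem Admissible.inner_pilot_eq_ite (hS : S.Admissible) (j k : Fin K) :
    inner ℂ (S.pilot j) (S.pilot k) = if S.p j = S.p k then (1 : ℂ) else 0 := by
  obtain ⟨t, t', ht, ht', hiff⟩ := hS.exists_pilotIndex j k
  simp only [hiff]
  simp [pilot, ht, ht', Pi.single_apply, orthonormal_iff_ite.1 hS.φ_orthonormal]

theorem Admissible.norm_sum_inner (hS : S.Admissible) (j k : Fin K) :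
    ‖∑ t, ∑ t', (S.p j t : ℂ) * (S.p k t' : ℂ) * inner ℂ (S.φ t) (S.φ t')‖ =
      if S.p j = S.p k then 1 else 0 := by
  rw [← inner_pilot_pilot, hS.inner_pilot_eq_ite, apply_ite norm, norm_one, norm_zero]

/-- The normalized power of the pilot-phase signal at access point `m` along the pilot of user
`k`. -/
noncomputable def pilotPower (S : CellFree M K L τ) (m : Fin M) (k : Fin K) : ℝ :=
  τ * S.ρp * ∑ j, (if S.p j = S.p k then S.β m j else 0) + 1

theorem Admissible.pilotPower_pos (hS : S.Admissible) (m : Fin M) (k : Fin K) :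
    0 < S.pilotPower m k := by
  have hρ := hS.ρp_nonneg
  have hβ : ∀ j, 0 ≤ if S.p j = S.p k then S.β m j else 0 := fun j =>
    ite_nonneg (hS.β_pos m j).le le_rfl
  have hsum := Finset.sum_nonneg fun j (_ : j ∈ Finset.univ) => hβ j
  unfold pilotPower
  positivity

theorem Admissible.c_eq (hS : S.Admissible) (m : Fin M) (k : Fin K) :
    S.c m k = √(τ * S.ρp) * S.β m k / S.pilotPower m k := by
  simp_rw [c, pilotPower, ← Finset.mul_sum, hS.sum_norm_inner, mul_ite, mul_one, mul_zero]

theorem Admissible.c_mul_pilotPower (hS : S.Admissible) (m : Fin M) (k : Fin K) :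
    S.c m k * S.pilotPower m k = √(τ * S.ρp) * S.β m k := by
  rw [hS.c_eq, div_mul_cancel₀ _ (hS.pilotPower_pos m k).ne']

theorem Admissible.downlinkRate_eq_of_orthonormal (hS : S.Admissible) (k : Fin K)
    {φ' : Fin τ → EuclideanSpace ℂ (Fin τ)} (hφ' : Orthonormal ℂ φ') :
    ({ S with φ := φ' } : CellFree M K L τ).downlinkRate k = S.downlinkRate k := by
  have hS' : ({ S with φ := φ' } : CellFree M K L τ).Admissible := { hS with φ_orthonormal := hφ' }
  have hγ : ∀ m j, ({ S with φ := φ' } : CellFree M K L τ).γ m j = S.γ m j := fun m j => by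
    rw [γ, γ, hS.c_eq, hS'.c_eq]
    rfl
  simp_rw [downlinkRate, hS.norm_sum_inner, hS'.norm_sum_inner, hγ]

end Pilots

section LinearRepresentation

variable {M K L τ : ℕ} {Ω : Type*} {S : CellFree M K L τ}

/-- The type indexing the family `allRV`. -/
abbrev Index (M K L τ : ℕ) : Type :=
  (Fin M × Fin K × Fin L) ⊕ (Fin M × Fin L × Fin τ) ⊕ Fin K ⊕ Fin K

/-- The indices in `allRV` of the channels and pilot-phase noises at antenna `l` of access point
`m`. -/
def antennaIndex (m : Fin M) (l : Fin L) : Fin K ⊕ Fin τ → Index M K L τ :=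
  Sum.elim (fun i => .inl (m, i, l)) (fun s => .inr (.inl (m, l, s)))

theorem eq_of_antennaIndex_eq {m m' : Fin M} {l l' : Fin L} {i i' : Fin K ⊕ Fin τ}
    (h : antennaIndex m l i = antennaIndex m' l' i') : m = m' ∧ l = l' ∧ i = i' := by
  rcases i with i | s <;> rcases i' with i' | s' <;> simp_all [antennaIndex]

/-- The channels and pilot-phase noises at antenna `l` of access point `m`. -/
def antennaRV (Z : CellFreeRV M K L τ Ω) (m : Fin M) (l : Fin L) (i : Fin K ⊕ Fin τ) : Ω → ℂ :=
  allRV Z (antennaIndex m l i)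

/-- The second moments of `antennaRV`. -/
def antennaVar (S : CellFree M K L τ) (m : Fin M) : Fin K ⊕ Fin τ → ℝ :=
  Sum.elim (S.β m) 1

/-- The coefficients of entry `s` of the received pilot-phase signal in `antennaRV`. -/
noncomputable def rxCoef (S : CellFree M K L τ) (s : Fin τ) : Fin K ⊕ Fin τ → ℂ :=
  Sum.elim (fun i => (√(τ * S.ρp) : ℂ) * conj (S.pilot i s)) (Pi.single s 1)

/-- The coefficients of the channel estimate in `antennaRV`. -/
noncomputable def estCoef (S : CellFree M K L τ) (m : Fin M) (j : Fin K) (i : Fin K ⊕ Fin τ) : ℂ :=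
  S.c m j * ∑ s, S.pilot j s * S.rxCoef s i

theorem pilotRx_eq (S : CellFree M K L τ) (Z : CellFreeRV M K L τ Ω) (m : Fin M) (l : Fin L)
    (s : Fin τ) (ω : Ω) :
    S.pilotRx Z m l s ω = ∑ i, S.rxCoef s i * antennaRV Z m l i ω := by
  simp only [pilotRx, Fintype.sum_sum_type, rxCoef, Sum.elim_inl, Sum.elim_inr, pilot_apply,
    map_sum, map_mul, map_natCast, Finset.mul_sum, Finset.sum_mul]
  congr 1
  · refine Finset.sum_congr rfl fun i _ => Finset.sum_congr rfl fun t _ => ?_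
    simp only [antennaRV, antennaIndex, allRV, Sum.elim_inl]
    ring
  · simp [Pi.single_apply, antennaRV, antennaIndex, allRV]

theorem estimate_eq_sum_pilotRx (S : CellFree M K L τ) (Z : CellFreeRV M K L τ Ω) (m : Fin M)
    (j : Fin K) (l : Fin L) (ω : Ω) :
    S.estimate Z m j l ω = ∑ s, S.c m j * S.pilot j s * S.pilotRx Z m l s ω := by
  simp_rw [estimate, ← pilot_apply, Finset.mul_sum]
  exact Finset.sum_congr rfl fun s _ => by ring

theorem estimate_eq (S : CellFree M K L τ) (Z : CellFreeRV M K L τ Ω) (m : Fin M) (j : Fin K)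
    (l : Fin L) (ω : Ω) :
    S.estimate Z m j l ω = ∑ i, S.estCoef m j i * antennaRV Z m l i ω := by
  simp_rw [estimate_eq_sum_pilotRx, pilotRx_eq, estCoef, Finset.mul_sum, Finset.sum_mul]
  rw [Finset.sum_comm]
  exact Finset.sum_congr rfl fun i _ => Finset.sum_congr rfl fun s _ => by ring

theorem Admissible.estCoef_inl (hS : S.Admissible) (m : Fin M) (j i : Fin K) :
    S.estCoef m j (.inl i) = if S.p i = S.p j then (√(τ * S.ρp) : ℂ) * S.c m j else 0 := by
  have hsum : ∑ s, S.pilot j s * ((√(τ * S.ρp) : ℂ) * conj (S.pilot i s)) =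
      √(τ * S.ρp) * inner ℂ (S.pilot i) (S.pilot j) := by
    rw [← sum_conj_pilot_mul_pilot, Finset.mul_sum]
    exact Finset.sum_congr rfl fun s _ => by ring
  simp only [estCoef, rxCoef, Sum.elim_inl, hsum, hS.inner_pilot_eq_ite]
  split_ifs <;> ring

theorem estCoef_inr (S : CellFree M K L τ) (m : Fin M) (j : Fin K) (s : Fin τ) :
    S.estCoef m j (.inr s) = S.c m j * S.pilot j s := by
  simp [estCoef, rxCoef, Pi.single_apply]

theorem Admissible.sqrt_mul_sqrt (hS : S.Admissible) :
    (√(τ * S.ρp) : ℂ) * √(τ * S.ρp) = τ * S.ρp := by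
  rw [← Complex.ofReal_mul, Real.mul_self_sqrt (mul_nonneg τ.cast_nonneg hS.ρp_nonneg)]
  push_cast
  rfl

theorem Admissible.sum_estCoef_mul_conj_rxCoef (hS : S.Admissible) (m : Fin M) (j : Fin K)
    (s : Fin τ) :
    ∑ i, S.estCoef m j i * conj (S.rxCoef s i) * S.antennaVar m i =
      √(τ * S.ρp) * S.β m j * S.pilot j s := by
  have hchannel : ∀ i, S.estCoef m j (.inl i) * conj (S.rxCoef s (.inl i)) *
      S.antennaVar m (.inl i) =
      S.c m j * S.pilot j s * (τ * S.ρp) * ((if S.p i = S.p j then S.β m i else 0 : ℝ) : ℂ) := by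
    intro i
    rw [← hS.sqrt_mul_sqrt]
    simp only [hS.estCoef_inl, rxCoef, antennaVar, Sum.elim_inl, map_mul, Complex.conj_ofReal,
      Complex.conj_conj]
    split_ifs with h
    · rw [pilot_congr h]
      ring
    · simp
  have hnoise : ∑ s', S.estCoef m j (.inr s') * conj (S.rxCoef s (.inr s')) *
      S.antennaVar m (.inr s') = S.c m j * S.pilot j s := by
    simp [estCoef_inr, rxCoef, antennaVar, Pi.single_apply]
  rw [Fintype.sum_sum_type, hnoise, ← Complex.ofReal_mul, ← hS.c_mul_pilotPower, pilotPower]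
  simp_rw [hchannel, ← Finset.mul_sum]
  push_cast
  ring

theorem Admissible.sum_estCoef_mul_conj_estCoef (hS : S.Admissible) (m : Fin M) (j : Fin K) :
    ∑ i, S.estCoef m j i * conj (S.estCoef m j i) * S.antennaVar m i = S.γ m j :=
  calc ∑ i, S.estCoef m j i * conj (S.estCoef m j i) * S.antennaVar m i
    _ = ∑ s, S.c m j * conj (S.pilot j s) *
          ∑ i, S.estCoef m j i * conj (S.rxCoef s i) * S.antennaVar m i := by
      simp_rw [Finset.mul_sum]
      rw [Finset.sum_comm]
      refine Finset.sum_congr rfl fun i _ => ?_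
      nth_rw 2 [estCoef]
      simp_rw [map_mul, map_sum, map_mul, Complex.conj_ofReal, Finset.mul_sum, Finset.sum_mul]
      exact Finset.sum_congr rfl fun s _ => by ring
    _ = √(τ * S.ρp) * S.β m j * S.c m j * ∑ s, conj (S.pilot j s) * S.pilot j s := by
      simp_rw [hS.sum_estCoef_mul_conj_rxCoef, Finset.mul_sum]
      exact Finset.sum_congr rfl fun s _ => by ring
    _ = S.γ m j := by
      rw [sum_conj_pilot_mul_pilot, hS.inner_pilot_eq_ite, if_pos rfl, γ]
      push_cast
      ring

theorem Admissible.estCoef_mul_eq (hS : S.Admissible) (m : Fin M) (j k : Fin K) :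
    S.estCoef m j (.inl k) * S.β m k =
      ((if S.p j = S.p k then S.γ m j * (S.β m k / S.β m j) else 0 : ℝ) : ℂ) := by
  have hβ := (hS.β_pos m j).ne'
  rw [hS.estCoef_inl, γ]
  simp only [eq_comm (a := S.p k)]
  split_ifs
  · rw [← Complex.ofReal_mul, ← Complex.ofReal_mul]
    congr 1
    field_simp
  · simp

end LinearRepresentation

section Measurability

variable {M K L τ : ℕ} {Ω : Type*} {mΩ : MeasurableSpace Ω} (S : CellFree M K L τ)
  {Z : CellFreeRV M K L τ Ω} {m : Fin M} {l : Fin L}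

theorem measurable_pilotRx (h : ∀ i, Measurable (antennaRV Z m l i)) (s : Fin τ) :
    Measurable (S.pilotRx Z m l s) := by
  rw [funext (S.pilotRx_eq Z m l s)]
  exact Finset.measurable_fun_sum _ fun i _ => (h i).const_mul _

theorem measurable_estimate (h : ∀ i, Measurable (antennaRV Z m l i)) (j : Fin K) :
    Measurable (S.estimate Z m j l) := by
  rw [funext (S.estimate_eq Z m j l)]
  exact Finset.measurable_fun_sum _ fun i _ => (h i).const_mul _

theorem measurable_conj_mul_estimate (h : ∀ i, Measurable (antennaRV Z m l i)) (k j : Fin K) :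
    Measurable fun ω => conj (Z.g m k l ω) * S.estimate Z m j l ω :=
  (Complex.continuous_conj.measurable.comp (h (.inl k))).mul (S.measurable_estimate h j)

theorem measurable_antennaRV_generatedBy (Z : CellFreeRV M K L τ Ω) (m : Fin M) (l : Fin L)
    (i : Fin K ⊕ Fin τ) :
    Measurable[generatedBy (allRV Z) (Set.range (antennaIndex m l))] (antennaRV Z m l i) :=
  measurable_generatedBy (allRV Z) ⟨i, rfl⟩

end Measurability

section Moments

variable {M K L τ : ℕ} {Ω : Type*} [MeasurableSpace Ω]

/-- The properties of the model on which the closed form rests: independence, and the moments of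
the random quantities instead of their laws. -/
structure IsMomentModel (S : CellFree M K L τ) (P : Measure Ω) (Z : CellFreeRV M K L τ Ω) :
    Prop where
  measurable : ∀ i, Measurable (allRV Z i)
  indep : iIndepFun (allRV Z) P
  g_mean : ∀ m k l, ∫ ω, Z.g m k l ω ∂P = 0
  g_power : ∀ m k l, ∫ ω, ‖Z.g m k l ω‖ ^ 2 ∂P = S.β m k
  g_fourth : ∀ m k l, ∫ ω, ‖Z.g m k l ω‖ ^ 4 ∂P = 2 * S.β m k ^ 2
  W_mean : ∀ m l s, ∫ ω, Z.W m l s ω ∂P = 0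
  W_power : ∀ m l s, ∫ ω, ‖Z.W m l s ω‖ ^ 2 ∂P = 1
  w_power : ∀ k, ∫ ω, ‖Z.w k ω‖ ^ 2 ∂P = 1
  q_mean : ∀ k, ∫ ω, Z.q k ω ∂P = 0
  q_power : ∀ k, ∫ ω, ‖Z.q k ω‖ ^ 2 ∂P = 1

variable {S : CellFree M K L τ} {P : Measure Ω} {Z : CellFreeRV M K L τ Ω}

theorem IsModel.isMomentModel (hZ : S.IsModel P Z) (hS : S.Admissible) :
    S.IsMomentModel P Z := by
  have hmean : ∀ {X : Ω → ℂ} {v : ℝ}, Measurable X → 0 < v → P.map X = complexGaussian v →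
      ∫ ω, X ω ∂P = 0 := fun hX hv hlaw => by
    rw [← integral_complexGaussian_id hv, ← hlaw, integral_map hX.aemeasurable (by fun_prop)]
  have hpow : ∀ {X : Ω → ℂ} {v : ℝ} (n : ℕ), Measurable X → 0 < v →
      P.map X = complexGaussian v →
      ∫ ω, ‖X ω‖ ^ (2 * n) ∂P = n.factorial * v ^ n := fun n hX hv hlaw => by
    rw [← integral_norm_pow_complexGaussian hv, ← hlaw,
      integral_map hX.aemeasurable (by fun_prop)]
  have hg : ∀ m k l, Measurable (Z.g m k l) := fun m k l => hZ.measurable (.inl (m, k, l))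
  have hW : ∀ m l s, Measurable (Z.W m l s) := fun m l s =>
    hZ.measurable (.inr (.inl (m, l, s)))
  have hw : ∀ k, Measurable (Z.w k) := fun k => hZ.measurable (.inr (.inr (.inr k)))
  exact
    { measurable := hZ.measurable
      indep := hZ.indep
      g_mean := fun m k l => hmean (hg m k l) (hS.β_pos m k) (hZ.g_law m k l)
      g_power := fun m k l => by
        simpa using hpow 1 (hg m k l) (hS.β_pos m k) (hZ.g_law m k l)
      g_fourth := fun m k l => by
        simpa using hpow 2 (hg m k l) (hS.β_pos m k) (hZ.g_law m k l)
      W_mean := fun m l s => hmean (hW m l s) one_pos (hZ.W_law m l s)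
      W_power := fun m l s => by simpa using hpow 1 (hW m l s) one_pos (hZ.W_law m l s)
      w_power := fun k => by simpa using hpow 1 (hw k) one_pos (hZ.w_law k)
      q_mean := hZ.q_mean
      q_power := hZ.q_power }

theorem IsMomentModel.memLp_four_g (hZ : S.IsMomentModel P Z) (hS : S.Admissible) (m : Fin M)
    (k : Fin K) (l : Fin L) : MemLp (Z.g m k l) 4 P := by
  have hmeas : Measurable (Z.g m k l) := hZ.measurable (.inl (m, k, l))
  have hβ := hS.β_pos m k
  exact_mod_cast memLp_of_integral_norm_pow_ne_zero hmeas.aestronglyMeasurable four_ne_zero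
    (by rw [hZ.g_fourth]; positivity)

theorem IsMomentModel.integral_antennaRV (hZ : S.IsMomentModel P Z) (m : Fin M) (l : Fin L)
    (i : Fin K ⊕ Fin τ) : ∫ ω, antennaRV Z m l i ω ∂P = 0 := by
  rcases i with i | s
  · exact hZ.g_mean m i l
  · exact hZ.W_mean m l s

theorem IsMomentModel.integral_norm_sq_antennaRV (hZ : S.IsMomentModel P Z) (m : Fin M)
    (l : Fin L) (i : Fin K ⊕ Fin τ) :
    ∫ ω, ‖antennaRV Z m l i ω‖ ^ 2 ∂P = S.antennaVar m i := by
  rcases i with i | s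
  · exact hZ.g_power m i l
  · exact hZ.W_power m l s

theorem Admissible.antennaVar_pos (hS : S.Admissible) (m : Fin M) (i : Fin K ⊕ Fin τ) :
    0 < S.antennaVar m i := by
  rcases i with i | _
  · exact hS.β_pos m i
  · exact one_pos

theorem IsMomentModel.memLp_two_antennaRV (hZ : S.IsMomentModel P Z) (hS : S.Admissible)
    (m : Fin M) (l : Fin L) (i : Fin K ⊕ Fin τ) : MemLp (antennaRV Z m l i) 2 P := by
  exact_mod_cast memLp_of_integral_norm_pow_ne_zero
    (hZ.measurable (antennaIndex m l i)).aestronglyMeasurable two_ne_zero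
    (by rw [← antennaRV, hZ.integral_norm_sq_antennaRV]; exact (hS.antennaVar_pos m i).ne')

theorem IsMomentModel.memLp_two_g (hZ : S.IsMomentModel P Z) (hS : S.Admissible) (m : Fin M)
    (k : Fin K) (l : Fin L) : MemLp (Z.g m k l) 2 P :=
  hZ.memLp_two_antennaRV hS m l (.inl k)

theorem IsMomentModel.memLp_two_sum_antennaRV (hZ : S.IsMomentModel P Z) (hS : S.Admissible)
    (m : Fin M) (l : Fin L) (T : Finset (Fin K ⊕ Fin τ)) (a : Fin K ⊕ Fin τ → ℂ) :
    MemLp (fun ω => ∑ i ∈ T, a i * antennaRV Z m l i ω) 2 P :=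
  memLp_finsetSum _ fun i _ => (hZ.memLp_two_antennaRV hS m l i).const_mul _

theorem IsMomentModel.memLp_two_estimate (hZ : S.IsMomentModel P Z) (hS : S.Admissible)
    (m : Fin M) (j : Fin K) (l : Fin L) : MemLp (S.estimate Z m j l) 2 P := by
  rw [funext (S.estimate_eq Z m j l)]
  exact hZ.memLp_two_sum_antennaRV hS m l _ _

theorem IsMomentModel.memLp_two_pilotRx (hZ : S.IsMomentModel P Z) (hS : S.Admissible)
    (m : Fin M) (l : Fin L) (s : Fin τ) : MemLp (S.pilotRx Z m l s) 2 P := by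
  rw [funext (S.pilotRx_eq Z m l s)]
  exact hZ.memLp_two_sum_antennaRV hS m l _ _

theorem IsMomentModel.integral_sum_mul_conj_sum_antennaRV (hZ : S.IsMomentModel P Z)
    (hS : S.Admissible) (m : Fin M) (l : Fin L) (a b : Fin K ⊕ Fin τ → ℂ) :
    ∫ ω, (∑ i, a i * antennaRV Z m l i ω) * conj (∑ i, b i * antennaRV Z m l i ω) ∂P =
      ∑ i, a i * conj (b i) * S.antennaVar m i := by
  have horth : Pairwise fun i i' =>
      ∫ ω, antennaRV Z m l i ω * conj (antennaRV Z m l i' ω) ∂P = 0 := fun i i' hne => by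
    have hind : IndepFun (antennaRV Z m l i) (antennaRV Z m l i') P :=
      hZ.indep.indepFun fun h => hne (eq_of_antennaIndex_eq h).2.2
    beta_reduce
    rw [integral_mul_conj_of_indepFun hind (hZ.memLp_two_antennaRV hS m l i).1
      (hZ.memLp_two_antennaRV hS m l i').1, hZ.integral_antennaRV, zero_mul]
  rw [integral_sum_mul_conj_sum (hZ.memLp_two_antennaRV hS m l) horth]
  simp_rw [hZ.integral_norm_sq_antennaRV]
  rfl

theorem IsMomentModel.integral_norm_sq_estimate (hZ : S.IsMomentModel P Z) (hS : S.Admissible)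
    (m : Fin M) (j : Fin K) (l : Fin L) :
    ∫ ω, ‖S.estimate Z m j l ω‖ ^ 2 ∂P = S.γ m j := by
  apply Complex.ofReal_injective
  rw [← hS.sum_estCoef_mul_conj_estCoef, ← hZ.integral_sum_mul_conj_sum_antennaRV hS m l]
  simp_rw [← estimate_eq]
  exact (integral_mul_conj_self _).symm

theorem IsMomentModel.integral_g_mul_conj_pilotRx (hZ : S.IsMomentModel P Z) (hS : S.Admissible)
    (m : Fin M) (j : Fin K) (l : Fin L) (s : Fin τ) :
    ∫ ω, Z.g m j l ω * conj (S.pilotRx Z m l s ω) ∂P =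
      √(τ * S.ρp) * S.β m j * S.pilot j s := by
  have hg : ∀ ω, Z.g m j l ω = ∑ i, (Pi.single (.inl j) 1 : Fin K ⊕ Fin τ → ℂ) i *
      antennaRV Z m l i ω := fun ω => by
    simp only [Pi.single_apply, ite_mul, one_mul, zero_mul, Finset.sum_ite_eq', Finset.mem_univ,
      if_true]
    rfl
  simp_rw [hg, pilotRx_eq, hZ.integral_sum_mul_conj_sum_antennaRV hS m l, Pi.single_apply]
  simp [rxCoef, antennaVar, mul_right_comm]

theorem IsMomentModel.integral_estimate_mul_conj_pilotRx (hZ : S.IsMomentModel P Z)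
    (hS : S.Admissible) (m : Fin M) (j : Fin K) (l : Fin L) (s : Fin τ) :
    ∫ ω, S.estimate Z m j l ω * conj (S.pilotRx Z m l s ω) ∂P =
      √(τ * S.ρp) * S.β m j * S.pilot j s := by
  simp_rw [estimate_eq, pilotRx_eq, hZ.integral_sum_mul_conj_sum_antennaRV hS m l,
    hS.sum_estCoef_mul_conj_rxCoef]

theorem IsMomentModel.indepFun_of_antenna_ne (hZ : S.IsMomentModel P Z) {m m' : Fin M}
    {l l' : Fin L} (h : (m, l) ≠ (m', l')) {X Y : Ω → ℂ}
    (hX : Measurable[generatedBy (allRV Z) (Set.range (antennaIndex m l))] X)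
    (hY : Measurable[generatedBy (allRV Z) (Set.range (antennaIndex m' l'))] Y) :
    IndepFun X Y P := by
  refine indepFun_of_disjoint hZ.measurable hZ.indep (Set.disjoint_left.2 ?_) hX hY
  rintro _ ⟨i, rfl⟩ ⟨i', hi'⟩
  obtain ⟨rfl, rfl, -⟩ := eq_of_antennaIndex_eq hi'
  exact h rfl

theorem IsMomentModel.integral_mul_conj_pilotRx_of_ne (hZ : S.IsMomentModel P Z)
    (hS : S.Admissible) {m : Fin M} {l l' : Fin L} (hl : l ≠ l') (s : Fin τ) {X : Ω → ℂ}
    (hX : MemLp X 2 P) (hX0 : ∫ ω, X ω ∂P = 0)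
    (hXm : Measurable[generatedBy (allRV Z) (Set.range (antennaIndex m l))] X) :
    ∫ ω, X ω * conj (S.pilotRx Z m l' s ω) ∂P = 0 := by
  have hind : IndepFun X (S.pilotRx Z m l' s) P :=
    hZ.indepFun_of_antenna_ne (fun h => hl (Prod.ext_iff.1 h).2) hXm
      (S.measurable_pilotRx (measurable_antennaRV_generatedBy Z m l') s)
  rw [integral_mul_conj_of_indepFun hind hX.1 (hZ.memLp_two_pilotRx hS m l' s).1, hX0, zero_mul]

variable [IsProbabilityMeasure P]

theorem IsMomentModel.integral_sum_antennaRV (hZ : S.IsMomentModel P Z) (hS : S.Admissible)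
    (m : Fin M) (l : Fin L) (T : Finset (Fin K ⊕ Fin τ)) (a : Fin K ⊕ Fin τ → ℂ) :
    ∫ ω, ∑ i ∈ T, a i * antennaRV Z m l i ω ∂P = 0 := by
  rw [integral_finsetSum _ fun i _ =>
    ((hZ.memLp_two_antennaRV hS m l i).integrable one_le_two).const_mul (a i)]
  simp_rw [integral_const_mul, hZ.integral_antennaRV, mul_zero, Finset.sum_const_zero]

theorem IsMomentModel.integral_g_mul_conj_pilotRx_eq_estimate (hZ : S.IsMomentModel P Z)
    (hS : S.Admissible) (m : Fin M) (j : Fin K) (l l' : Fin L) (s : Fin τ) :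
    ∫ ω, Z.g m j l ω * conj (S.pilotRx Z m l' s ω) ∂P =
      ∫ ω, S.estimate Z m j l ω * conj (S.pilotRx Z m l' s ω) ∂P := by
  have hest : ∫ ω, S.estimate Z m j l ω ∂P = 0 := by
    simp_rw [estimate_eq, hZ.integral_sum_antennaRV hS]
  have hmeas := measurable_antennaRV_generatedBy Z m l
  rcases eq_or_ne l l' with rfl | hl
  · rw [hZ.integral_g_mul_conj_pilotRx hS, hZ.integral_estimate_mul_conj_pilotRx hS]
  · rw [hZ.integral_mul_conj_pilotRx_of_ne hS hl s (hZ.memLp_two_g hS m j l)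
        (hZ.g_mean m j l) (hmeas (.inl j)),
      hZ.integral_mul_conj_pilotRx_of_ne hS hl s (hZ.memLp_two_estimate hS m j l) hest
        (S.measurable_estimate hmeas j)]

theorem IsMomentModel.isLMMSE_estimate (hZ : S.IsMomentModel P Z) (hS : S.Admissible)
    (m : Fin M) (j : Fin K) (l : Fin L) :
    IsLMMSE P (Z.g m j l) (fun (i : Fin L × Fin τ) ω => S.pilotRx Z m i.1 i.2 ω)
      (S.estimate Z m j l) := by
  let A : Fin L × Fin τ → ℂ := fun i => if i.1 = l then S.c m j * S.pilot j i.2 else 0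
  have hA : ∀ ω, ∑ i, A i * S.pilotRx Z m i.1 i.2 ω = S.estimate Z m j l ω := fun ω => by
    simp [A, estimate_eq_sum_pilotRx, Fintype.sum_prod_type_right]
  have hlmmse := isLMMSE_of_orthogonal (hZ.memLp_two_g hS m j l)
    (fun i : Fin L × Fin τ => hZ.memLp_two_pilotRx hS m i.1 i.2) A fun i => by
      simp_rw [hA, hZ.integral_g_mul_conj_pilotRx_eq_estimate hS]
  rwa [funext hA] at hlmmse

theorem IsMomentModel.exists_estimate_eq_add (hZ : S.IsMomentModel P Z) (hS : S.Admissible)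
    (m : Fin M) (k j : Fin K) (l : Fin L) :
    ∃ E : Ω → ℂ, MemLp E 2 P ∧ ∫ ω, E ω ∂P = 0 ∧ IndepFun (Z.g m k l) E P ∧
      ∀ ω, S.estimate Z m j l ω = S.estCoef m j (.inl k) * Z.g m k l ω + E ω := by
  refine ⟨fun ω => ∑ i ∈ Finset.univ.erase (.inl k), S.estCoef m j i * antennaRV Z m l i ω,
    hZ.memLp_two_sum_antennaRV hS m l _ _, hZ.integral_sum_antennaRV hS m l _ _, ?_, fun ω => ?_⟩
  · refine indepFun_of_disjoint hZ.measurable hZ.indep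
      (disjoint_compl_right (a := {antennaIndex m l (.inl k)}))
      (measurable_generatedBy (allRV Z) (Set.mem_singleton _))
      (Finset.measurable_fun_sum _ fun i hi => Measurable.const_mul
        (measurable_generatedBy (allRV Z) fun h => ?_) _)
    exact Finset.ne_of_mem_erase hi (eq_of_antennaIndex_eq h).2.2
  · rw [estimate_eq, ← Finset.add_sum_erase _ _ (Finset.mem_univ (.inl k))]
    rfl

theorem IsMomentModel.memLp_conj_mul_estimate (hZ : S.IsMomentModel P Z) (hS : S.Admissible)
    (m : Fin M) (k j : Fin K) (l : Fin L) :
    MemLp (fun ω => conj (Z.g m k l ω) * S.estimate Z m j l ω) 2 P := by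
  obtain ⟨E, hE, -, hind, hest⟩ := hZ.exists_estimate_eq_add hS m k j l
  simp_rw [hest]
  exact memLp_two_conj_mul_add_of_indepFun hind (hZ.memLp_four_g hS m k l) hE _

theorem IsMomentModel.integral_conj_mul_estimate (hZ : S.IsMomentModel P Z) (hS : S.Admissible)
    (m : Fin M) (k j : Fin K) (l : Fin L) :
    ∫ ω, conj (Z.g m k l ω) * S.estimate Z m j l ω ∂P = S.estCoef m j (.inl k) * S.β m k := by
  obtain ⟨E, hE, hE0, hind, hest⟩ := hZ.exists_estimate_eq_add hS m k j l
  simp_rw [hest, ← hZ.g_power m k l]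
  exact integral_conj_mul_add_of_indepFun hind (hZ.memLp_two_g hS m k l) hE hE0 _

theorem IsMomentModel.integral_norm_sq_conj_mul_estimate (hZ : S.IsMomentModel P Z)
    (hS : S.Admissible) (m : Fin M) (k j : Fin K) (l : Fin L) :
    ∫ ω, ‖conj (Z.g m k l ω) * S.estimate Z m j l ω‖ ^ 2 ∂P =
      ‖S.estCoef m j (.inl k) * S.β m k‖ ^ 2 + S.β m k * S.γ m j := by
  obtain ⟨E, hE, hE0, hind, hest⟩ := hZ.exists_estimate_eq_add hS m k j l
  rw [← hZ.integral_norm_sq_estimate hS m j l, ← hZ.g_power m k l]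
  simp_rw [hest]
  refine integral_norm_sq_conj_mul_add_of_indepFun hind (hZ.memLp_four_g hS m k l) hE hE0 ?_ _
  rw [hZ.g_fourth, hZ.g_power]

end Moments

section ReceivedSignal

variable {M K L τ : ℕ} {Ω : Type*}

/-- The random coefficient with which user `k` receives the symbol of user `j`; for `j = k` this
is `gain`. -/
noncomputable def crossGain (S : CellFree M K L τ) (Z : CellFreeRV M K L τ Ω) (k j : Fin K)
    (ω : Ω) : ℂ :=
  (√S.ρd : ℂ) * ∑ m, (√(S.η m j) : ℂ) * ∑ l, conj (Z.g m k l ω) * S.estimate Z m j l ω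

/-- What user `k` receives from the symbols of the users in `s`, together with its receiver
noise. -/
noncomputable def interference (S : CellFree M K L τ) (Z : CellFreeRV M K L τ Ω) (k : Fin K)
    (s : Finset (Fin K)) (ω : Ω) : ℂ :=
  ∑ j ∈ s, S.crossGain Z k j ω * Z.q j ω + Z.w k ω

variable (S : CellFree M K L τ) (Z : CellFreeRV M K L τ Ω)

theorem crossGain_self (k : Fin K) : S.crossGain Z k k = S.gain Z k :=
  rfl

theorem crossGain_eq_sum (k j : Fin K) (ω : Ω) :
    S.crossGain Z k j ω = ∑ i : Fin M × Fin L, ((√S.ρd * √(S.η i.1 j) : ℝ) : ℂ) *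
      (conj (Z.g i.1 k i.2 ω) * S.estimate Z i.1 j i.2 ω) := by
  simp_rw [Fintype.sum_prod_type, crossGain, Finset.mul_sum, Complex.ofReal_mul, mul_assoc]

theorem received_eq (k : Fin K) (x : Fin K → ℂ) (ω : Ω) :
    S.received Z k x ω = ∑ j, S.crossGain Z k j ω * x j + Z.w k ω := by
  simp_rw [received, transmit, crossGain_eq_sum, ← Fintype.sum_prod_type', Finset.mul_sum,
    Finset.sum_mul]
  rw [Finset.sum_comm]
  congr! 3
  push_cast
  ring

theorem userChannel_eq (k : Fin K) (x : ℂ) (ω : Ω) :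
    S.userChannel Z k x ω =
      S.gain Z k ω * x + S.interference Z k (Finset.univ.erase k) ω := by
  rw [userChannel, received_eq, ← Finset.add_sum_erase _ _ (Finset.mem_univ k),
    Function.update_self, crossGain_self, add_assoc, interference]
  congr 2
  exact Finset.sum_congr rfl fun j hj => by rw [Function.update_of_ne (Finset.ne_of_mem_erase hj)]

theorem effNoise_eq [MeasurableSpace Ω] (P : Measure Ω) (k : Fin K) (ω : Ω) :
    S.effNoise P Z k ω = (S.gain Z k ω - ∫ ω', S.gain Z k ω' ∂P) * Z.q k ω +
      S.interference Z k (Finset.univ.erase k) ω := by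
  rw [effNoise, received_eq, ← Finset.add_sum_erase _ _ (Finset.mem_univ k), crossGain_self,
    interference]
  ring

variable {Z} {mΩ : MeasurableSpace Ω}

theorem measurable_crossGain (h : ∀ m l i, Measurable (antennaRV Z m l i)) (k j : Fin K) :
    Measurable (S.crossGain Z k j) := by
  rw [funext (S.crossGain_eq_sum Z k j)]
  exact Finset.measurable_fun_sum _ fun i _ =>
    (S.measurable_conj_mul_estimate (h i.1 i.2) k j).const_mul _

theorem measurable_interference (h : ∀ m l i, Measurable (antennaRV Z m l i)) {k : Fin K}
    {s : Finset (Fin K)} (hq : ∀ j ∈ s, Measurable (Z.q j)) (hw : Measurable (Z.w k)) :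
    Measurable (S.interference Z k s) :=
  (Finset.measurable_fun_sum _ fun j hj => (S.measurable_crossGain h k j).mul (hq j hj)).add hw

end ReceivedSignal

section Gains

variable {M K L τ : ℕ} {Ω : Type*} [MeasurableSpace Ω] {S : CellFree M K L τ} {P : Measure Ω}
  {Z : CellFreeRV M K L τ Ω} [IsProbabilityMeasure P]

theorem IsMomentModel.memLp_two_crossGain (hZ : S.IsMomentModel P Z) (hS : S.Admissible)
    (k j : Fin K) : MemLp (S.crossGain Z k j) 2 P := by
  rw [funext (S.crossGain_eq_sum Z k j)]
  exact memLp_finsetSum _ fun i _ => (hZ.memLp_conj_mul_estimate hS i.1 k j i.2).const_mul _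

theorem IsMomentModel.memLp_two_gain (hZ : S.IsMomentModel P Z) (hS : S.Admissible) (k : Fin K) :
    MemLp (S.gain Z k) 2 P :=
  hZ.memLp_two_crossGain hS k k

theorem IsMomentModel.integral_crossGain (hZ : S.IsMomentModel P Z) (hS : S.Admissible)
    (k j : Fin K) :
    ∫ ω, S.crossGain Z k j ω ∂P = ((√S.ρd * L * ∑ m, √(S.η m j) *
      (if S.p j = S.p k then S.γ m j * (S.β m k / S.β m j) else 0) : ℝ) : ℂ) := by
  simp_rw [crossGain_eq_sum]
  rw [integral_finsetSum _ fun i _ =>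
    ((hZ.memLp_conj_mul_estimate hS i.1 k j i.2).integrable one_le_two).const_mul _]
  simp_rw [integral_const_mul, hZ.integral_conj_mul_estimate hS, hS.estCoef_mul_eq,
    ← Complex.ofReal_mul, ← Complex.ofReal_sum, Fintype.sum_prod_type, Finset.sum_const,
    Finset.card_univ, Fintype.card_fin, nsmul_eq_mul, Finset.mul_sum]
  congr! 2
  ring

theorem IsMomentModel.norm_sq_integral_crossGain (hZ : S.IsMomentModel P Z) (hS : S.Admissible)
    (k j : Fin K) :
    ‖∫ ω, S.crossGain Z k j ω ∂P‖ ^ 2 = S.ρd * (L : ℝ) ^ 2 *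
      ((∑ m, √(S.η m j) * S.γ m j * (S.β m k / S.β m j)) ^ 2 *
        ‖∑ t, ∑ t', (S.p j t : ℂ) * (S.p k t' : ℂ) * inner ℂ (S.φ t) (S.φ t')‖) := by
  rw [hZ.integral_crossGain hS, Complex.norm_real, Real.norm_eq_abs, sq_abs, mul_pow, mul_pow,
    Real.sq_sqrt hS.ρd_nonneg, hS.norm_sum_inner]
  split_ifs
  · simp_rw [mul_assoc, mul_one]
  · simp

theorem IsMomentModel.norm_sq_integral_gain (hZ : S.IsMomentModel P Z) (hS : S.Admissible)
    (k : Fin K) :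
    ‖∫ ω, S.gain Z k ω ∂P‖ ^ 2 = S.ρd * (L : ℝ) ^ 2 * (∑ m, √(S.η m k) * S.γ m k) ^ 2 := by
  have hβ : ∀ m, S.β m k / S.β m k = 1 := fun m => div_self (hS.β_pos m k).ne'
  rw [← crossGain_self, hZ.norm_sq_integral_crossGain hS, hS.norm_sum_inner, if_pos rfl]
  simp_rw [hβ, mul_one]

theorem IsMomentModel.integral_norm_sq_crossGain (hZ : S.IsMomentModel P Z) (hS : S.Admissible)
    (k j : Fin K) :
    ∫ ω, ‖S.crossGain Z k j ω‖ ^ 2 ∂P = ‖∫ ω, S.crossGain Z k j ω ∂P‖ ^ 2 +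
      S.ρd * L * ∑ m, S.η m j * S.γ m j * S.β m k := by
  let Y : Fin M × Fin L → Ω → ℂ := fun i ω =>
    ((√S.ρd * √(S.η i.1 j) : ℝ) : ℂ) * (conj (Z.g i.1 k i.2 ω) * S.estimate Z i.1 j i.2 ω)
  have hY : ∀ i, MemLp (Y i) 2 P := fun i =>
    (hZ.memLp_conj_mul_estimate hS i.1 k j i.2).const_mul _
  have hmeas : ∀ i, Measurable[generatedBy (allRV Z) (Set.range (antennaIndex i.1 i.2))] (Y i) :=
    fun i => (S.measurable_conj_mul_estimate
      (measurable_antennaRV_generatedBy Z i.1 i.2) k j).const_mul _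
  have hind : Pairwise fun i i' => IndepFun (Y i) (Y i') P := fun i i' hne =>
    hZ.indepFun_of_antenna_ne hne (hmeas i) (hmeas i')
  have hvar : ∀ i, ∫ ω, ‖Y i ω‖ ^ 2 ∂P - ‖∫ ω, Y i ω ∂P‖ ^ 2 =
      S.ρd * (S.η i.1 j * S.γ i.1 j * S.β i.1 k) := fun i => by
    simp_rw [Y, norm_mul (Complex.ofReal _), mul_pow, integral_const_mul,
      norm_mul (Complex.ofReal _), mul_pow, hZ.integral_norm_sq_conj_mul_estimate hS,
      hZ.integral_conj_mul_estimate hS, ← mul_sub, add_sub_cancel_left, Complex.norm_real,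
      Real.norm_eq_abs, sq_abs, mul_pow, Real.sq_sqrt hS.ρd_nonneg,
      Real.sq_sqrt (hS.η_nonneg _ _)]
    ring
  have hsum : ∀ ω, S.crossGain Z k j ω = ∑ i, Y i ω := S.crossGain_eq_sum Z k j
  simp_rw [hsum]
  rw [integral_norm_sq_sum_of_indepFun hY hind,
    integral_finsetSum _ fun i _ => (hY i).integrable one_le_two]
  simp_rw [hvar, Fintype.sum_prod_type, Finset.sum_const, Finset.card_univ, Fintype.card_fin,
    nsmul_eq_mul, ← Finset.mul_sum]
  ring

end Gains

section EffectiveNoise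

variable {M K L τ : ℕ} {Ω : Type*} [MeasurableSpace Ω] {S : CellFree M K L τ} {P : Measure Ω}
  {Z : CellFreeRV M K L τ Ω}

theorem IsMomentModel.memLp_two_q (hZ : S.IsMomentModel P Z) (k : Fin K) : MemLp (Z.q k) 2 P := by
  have hmeas : Measurable (Z.q k) := hZ.measurable (.inr (.inr (.inl k)))
  exact_mod_cast memLp_of_integral_norm_pow_ne_zero hmeas.aestronglyMeasurable two_ne_zero
    (by rw [hZ.q_power]; exact one_ne_zero)

theorem IsMomentModel.memLp_two_w (hZ : S.IsMomentModel P Z) (k : Fin K) : MemLp (Z.w k) 2 P := by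
  have hmeas : Measurable (Z.w k) := hZ.measurable (.inr (.inr (.inr k)))
  exact_mod_cast memLp_of_integral_norm_pow_ne_zero hmeas.aestronglyMeasurable two_ne_zero
    (by rw [hZ.w_power]; exact one_ne_zero)

theorem IsMomentModel.indepFun_q_interference (hZ : S.IsMomentModel P Z) (k : Fin K) {j : Fin K}
    {s : Finset (Fin K)} (hj : j ∉ s) :
    IndepFun (Z.q j) (fun ω => (S.crossGain Z k j ω, S.interference Z k s ω)) P := by
  have hrest : ∀ i ≠ .inr (.inr (.inl j)),
      Measurable[generatedBy (allRV Z) {.inr (.inr (.inl j))}ᶜ] (allRV Z i) := fun i hi =>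
    measurable_generatedBy (allRV Z) hi
  have hantenna : ∀ m l i,
      Measurable[generatedBy (allRV Z) {.inr (.inr (.inl j))}ᶜ] (antennaRV Z m l i) :=
    fun m l i => hrest (antennaIndex m l i) (by rcases i with i | i <;> simp [antennaIndex])
  have hq : ∀ i ∈ s, Measurable[generatedBy (allRV Z) {.inr (.inr (.inl j))}ᶜ] (Z.q i) :=
    fun i hi => hrest (.inr (.inr (.inl i))) (by simpa using ne_of_mem_of_not_mem hi hj)
  have hqj : Measurable[generatedBy (allRV Z) {.inr (.inr (.inl j))}] (Z.q j) :=
    measurable_generatedBy (allRV Z) (i := .inr (.inr (.inl j))) (Set.mem_singleton _)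
  have hw : Measurable[generatedBy (allRV Z) {.inr (.inr (.inl j))}ᶜ] (Z.w k) :=
    hrest (.inr (.inr (.inr k))) (by simp)
  exact indepFun_of_disjoint hZ.measurable hZ.indep disjoint_compl_right hqj
    ((S.measurable_crossGain hantenna k j).prodMk (S.measurable_interference hantenna hq hw))

theorem IsMomentModel.indepFun_q_gain_sub_interference (hZ : S.IsMomentModel P Z) (k : Fin K) :
    IndepFun (Z.q k) (fun ω => (S.gain Z k ω - ∫ ω', S.gain Z k ω' ∂P,
      S.interference Z k (Finset.univ.erase k) ω)) P :=
  (hZ.indepFun_q_interference k (Finset.notMem_erase k _)).comp measurable_id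
    ((measurable_fst.sub_const _).prodMk measurable_snd)

variable [IsProbabilityMeasure P]

theorem IsMomentModel.memLp_two_interference (hZ : S.IsMomentModel P Z) (hS : S.Admissible)
    (k : Fin K) (s : Finset (Fin K)) : MemLp (S.interference Z k s) 2 P := by
  have hind : ∀ j, IndepFun (S.crossGain Z k j) (Z.q j) P := fun j =>
    ((hZ.indepFun_q_interference k (Finset.notMem_empty j)).comp measurable_id
      measurable_fst).symm
  have hterm : ∀ j, MemLp (fun ω => S.crossGain Z k j ω * Z.q j ω) 2 P := fun j =>
    memLp_two_mul_of_indepFun (hind j) (hZ.memLp_two_crossGain hS k j) (hZ.memLp_two_q j)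
  exact (memLp_finsetSum _ fun j _ => hterm j).add (hZ.memLp_two_w k)

theorem IsMomentModel.integral_norm_sq_interference (hZ : S.IsMomentModel P Z)
    (hS : S.Admissible) (k : Fin K) (s : Finset (Fin K)) :
    ∫ ω, ‖S.interference Z k s ω‖ ^ 2 ∂P = ∑ j ∈ s, ∫ ω, ‖S.crossGain Z k j ω‖ ^ 2 ∂P + 1 := by
  induction s using Finset.induction_on with
  | empty => simp_rw [interference, Finset.sum_empty, zero_add, hZ.w_power]
  | insert j s hj ih =>
    have hinsert : ∀ ω, S.interference Z k (insert j s) ω =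
        S.crossGain Z k j ω * Z.q j ω + S.interference Z k s ω := fun ω => by
      rw [interference, Finset.sum_insert hj, add_assoc, ← interference]
    simp_rw [hinsert]
    rw [integral_norm_sq_mul_add_of_indepFun (hZ.indepFun_q_interference k hj) (hZ.memLp_two_q j)
      (hZ.memLp_two_crossGain hS k j) (hZ.memLp_two_interference hS k s) (hZ.q_mean j),
      hZ.q_power, mul_one, ih, Finset.sum_insert hj, add_assoc]

theorem IsMomentModel.memLp_two_gain_sub (hZ : S.IsMomentModel P Z) (hS : S.Admissible)
    (k : Fin K) : MemLp (fun ω => S.gain Z k ω - ∫ ω', S.gain Z k ω' ∂P) 2 P :=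
  (hZ.memLp_two_gain hS k).sub (memLp_const _)

theorem IsMomentModel.memLp_two_effNoise (hZ : S.IsMomentModel P Z) (hS : S.Admissible)
    (k : Fin K) : MemLp (S.effNoise P Z k) 2 P := by
  rw [funext (S.effNoise_eq Z P k)]
  exact memLp_two_mul_add_of_indepFun (hZ.indepFun_q_gain_sub_interference k) (hZ.memLp_two_q k)
    (hZ.memLp_two_gain_sub hS k) (hZ.memLp_two_interference hS k _)

theorem IsMomentModel.integral_norm_sq_effNoise_eq_add (hZ : S.IsMomentModel P Z)
    (hS : S.Admissible) (k : Fin K) :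
    ∫ ω, ‖S.effNoise P Z k ω‖ ^ 2 ∂P = ∫ ω, ‖S.gain Z k ω - ∫ ω', S.gain Z k ω' ∂P‖ ^ 2 ∂P +
      ∫ ω, ‖S.interference Z k (Finset.univ.erase k) ω‖ ^ 2 ∂P := by
  simp_rw [effNoise_eq]
  rw [integral_norm_sq_mul_add_of_indepFun (hZ.indepFun_q_gain_sub_interference k)
    (hZ.memLp_two_q k) (hZ.memLp_two_gain_sub hS k) (hZ.memLp_two_interference hS k _)
    (hZ.q_mean k), hZ.q_power, mul_one]

theorem IsMomentModel.integral_norm_sq_effNoise_pos (hZ : S.IsMomentModel P Z)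
    (hS : S.Admissible) (k : Fin K) : 0 < ∫ ω, ‖S.effNoise P Z k ω‖ ^ 2 ∂P := by
  rw [hZ.integral_norm_sq_effNoise_eq_add hS, hZ.integral_norm_sq_interference hS]
  positivity

theorem IsMomentModel.integral_norm_sq_effNoise (hZ : S.IsMomentModel P Z) (hS : S.Admissible)
    (k : Fin K) :
    ∫ ω, ‖S.effNoise P Z k ω‖ ^ 2 ∂P =
      S.ρd * (L : ℝ) ^ 2 * ∑ j ∈ Finset.univ.erase k,
          (∑ m, √(S.η m j) * S.γ m j * (S.β m k / S.β m j)) ^ 2 *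
            ‖∑ t, ∑ t', (S.p j t : ℂ) * (S.p k t' : ℂ) * inner ℂ (S.φ t) (S.φ t')‖
        + S.ρd * L * ∑ j, ∑ m, S.η m j * S.γ m j * S.β m k + 1 := by
  rw [hZ.integral_norm_sq_effNoise_eq_add hS, hZ.integral_norm_sq_interference hS,
    integral_norm_sub_integral_sq (hZ.memLp_two_gain hS k), ← crossGain_self]
  simp_rw [hZ.integral_norm_sq_crossGain hS]
  rw [add_sub_cancel_left, Finset.sum_add_distrib, ← Finset.mul_sum,
    ← Finset.add_sum_erase _ (fun j => ∑ m, S.η m j * S.γ m j * S.β m k) (Finset.mem_univ k)]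
  simp_rw [hZ.norm_sq_integral_crossGain hS, ← Finset.mul_sum]
  ring

end EffectiveNoise

section Throughput

variable {M K L τ : ℕ} {Ω : Type*} [MeasurableSpace Ω] {S : CellFree M K L τ} {P : Measure Ω}
  [IsProbabilityMeasure P] {Z : CellFreeRV M K L τ Ω}

theorem IsMomentModel.ergodicThroughput_eq (hZ : S.IsMomentModel P Z) (hS : S.Admissible)
    (k : Fin K) : S.ergodicThroughput P Z k = S.downlinkRate k := by
  rw [ergodicThroughput, downlinkRate, hZ.norm_sq_integral_gain hS,
    hZ.integral_norm_sq_effNoise hS]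

theorem IsMomentModel.ofReal_ergodicThroughput_le (hZ : S.IsMomentModel P Z) (hS : S.Admissible)
    (k : Fin K) :
    ENNReal.ofReal (S.ergodicThroughput P Z k) ≤
      ENNReal.ofReal S.B * channelCapacity P (S.userChannel Z k) := by
  have hantenna : ∀ m l i, Measurable (antennaRV Z m l i) := fun m l i =>
    hZ.measurable (antennaIndex m l i)
  have hgain : Measurable (S.gain Z k) := S.measurable_crossGain hantenna k k
  have hinterference : Measurable (S.interference Z k (Finset.univ.erase k)) :=
    S.measurable_interference hantenna (fun j _ => hZ.measurable (.inr (.inr (.inl j))))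
      (hZ.measurable (.inr (.inr (.inr k))))
  have hpos := hZ.integral_norm_sq_effNoise_pos hS k
  rw [hZ.integral_norm_sq_effNoise_eq_add hS] at hpos
  rw [ergodicThroughput, ENNReal.ofReal_mul hS.B_nonneg, hZ.integral_norm_sq_effNoise_eq_add hS,
    funext₂ (S.userChannel_eq Z k)]
  gcongr
  exact ofReal_logb_le_channelCapacity hgain hinterference (hZ.memLp_two_gain hS k)
    (hZ.memLp_two_interference hS k _) hpos

end Throughput

end CellFree

theorem lemma1_general {M K L τ : ℕ} {Ω : Type*} [MeasurableSpace Ω]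
    (P : Measure Ω) [IsProbabilityMeasure P]
    (S : CellFree M K L τ) (hS : S.Admissible)
    (Z : CellFreeRV M K L τ Ω) (hZ : S.IsMomentModel P Z) (k : Fin K) :
    (∀ m j l, IsLMMSE P (Z.g m j l)
        (fun (i : Fin L × Fin τ) ω => S.pilotRx Z m i.1 i.2 ω) (S.estimate Z m j l)) ∧
    (∀ m j l, MemLp (S.estimate Z m j l) 2 P ∧
        ∫ ω, ‖S.estimate Z m j l ω‖ ^ 2 ∂P = S.γ m j) ∧
    Integrable (S.gain Z k) P ∧ MemLp (S.effNoise P Z k) 2 P ∧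
    0 < ∫ ω, ‖S.effNoise P Z k ω‖ ^ 2 ∂P ∧
    S.ergodicThroughput P Z k = S.downlinkRate k ∧
    ENNReal.ofReal (S.downlinkRate k) ≤
      ENNReal.ofReal S.B * channelCapacity P (S.userChannel Z k) ∧
    (∀ φ' : Fin τ → EuclideanSpace ℂ (Fin τ), Orthonormal ℂ φ' →
      ({ S with φ := φ' } : CellFree M K L τ).downlinkRate k = S.downlinkRate k) :=
  ⟨hZ.isLMMSE_estimate hS,
    fun m j l => ⟨hZ.memLp_two_estimate hS m j l, hZ.integral_norm_sq_estimate hS m j l⟩,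
    (hZ.memLp_two_gain hS k).integrable one_le_two,
    hZ.memLp_two_effNoise hS k,
    hZ.integral_norm_sq_effNoise_pos hS k,
    hZ.ergodicThroughput_eq hS k,
    hZ.ergodicThroughput_eq hS k ▸ hZ.ofReal_ergodicThroughput_le hS k,
    fun _ => hS.downlinkRate_eq_of_orthonormal k⟩

theorem lemma1 {M K L τ : ℕ} {Ω : Type*} [MeasurableSpace Ω]
    (P : Measure Ω) [IsProbabilityMeasure P]
    (S : CellFree M K L τ) (hS : S.Admissible)
    (Z : CellFreeRV M K L τ Ω) (hZ : S.IsModel P Z) (k : Fin K) :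
    -- the channel estimates are the LMMSE estimates, with second moments `γ`
    (∀ m j l, IsLMMSE P (Z.g m j l)
        (fun (i : Fin L × Fin τ) ω => S.pilotRx Z m i.1 i.2 ω) (S.estimate Z m j l)) ∧
    (∀ m j l, MemLp (S.estimate Z m j l) 2 P ∧
        ∫ ω, ‖S.estimate Z m j l ω‖ ^ 2 ∂P = S.γ m j) ∧
    -- the use-and-then-forget throughput is well defined and has the closed form
    Integrable (S.gain Z k) P ∧ MemLp (S.effNoise P Z k) 2 P ∧
    0 < ∫ ω, ‖S.effNoise P Z k ω‖ ^ 2 ∂P ∧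
    S.ergodicThroughput P Z k = S.downlinkRate k ∧
    -- it is achievable: it does not exceed bandwidth times capacity
    ENNReal.ofReal (S.downlinkRate k) ≤
      ENNReal.ofReal S.B * channelCapacity P (S.userChannel Z k) ∧
    -- it depends on the pilots only through their assignment
    (∀ φ' : Fin τ → EuclideanSpace ℂ (Fin τ), Orthonormal ℂ φ' →
      ({ S with φ := φ' } : CellFree M K L τ).downlinkRate k = S.downlinkRate k) :=
  lemma1_general P S hS Z (hZ.isMomentModel hS) k
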